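/- **Nonlinear Hanson–Wright inequality.** Throughout, $\|\cdot\|$ is the Euclidean norm of vectors and the spectral norm of matrices, and $\|\cdot\|_F$ is the Frobenius norm. A random vector $Z$ in $\mathbb R^{d}$ has the *$K$-concentration property* ($K>0$) if for every $1$-Lipschitz $f:\mathbb R^{d}\to\mathbb R$ one has $\mathbb E|f(Z)|<\infty$ and $\mathbb P(|f(Z)-\mathbb E f(Z)|\ge t)\le 2\exp(-t^2/K^2)$ for all $t>0$. There is an absolute constant $C>0$ such that the following holds. Let $w$ be a random vector in $\mathbb R^{d_0}$, let $X=(x_1,\dots,x_n)\in\mathbb R^{d_0\times n}$ and $A\in\mathbb R^{n\times n}$ be deterministic, and let $\sigma:\mathbb R\to\mathbb R$ be $\lambda_\sigma$-Lipschitz. Put $y=\sigma(w^\top X)^\top\in\mathbb R^n$ ($\sigma$ applied entrywise) and $\Phi=\mathbb E[yy^\top]$. (If $\lambda_\sigma=0$, $X=0$ or $A=0$, so that denominators below vanish, then $y^\top Ay=\operatorname{Tr}(A\Phi)$ identically.) **(I)** Suppose that $w$ has the $K$-concentration property. Then $y$ is square integrable and: 1. if $\mathbb E y=0$, then for all $t>0$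 $$\mathbb P\big(|y^\top Ay-\operatorname{Tr}(A\Phi)|\ge t\big)\le 2\exp\Big(-\tfrac1C\min\Big\{\tfrac{t^2}{2K^4\lambda_\sigma^4\|X\|^4\|A\|_F^2},\tfrac{t}{K^2\lambda_\sigma^2\|X\|^2\|A\|}\Big\}\Big);$$ 2. if $\mathbb E y\ne0$, then for all $t>0$ $$\mathbb P\big(|y^\top Ay-\operatorname{Tr}(A\Phi)|> t\big)\le 2\exp\Big(-\tfrac1C\min\Big\{\tfrac{t^2}{4K^4\lambda_\sigma^4\|X\|^4\|A\|_F^2},\tfrac{t}{K^2\lambda_\sigma^2\|X\|^2\|A\|}\Big\}\Big)+2\exp\Big(-\tfrac{t^2}{16K^2\lambda_\sigma^2\|X\|^2\|A\|^2\|\mathbb E y\|^2}\Big).$$ **(II)** Suppose that $w\sim\mathcal N(0,I_{d_0})$. Then $y$ is square integrable and: 1. if $\mathbb E y=0$, then for all $t>0$ $$\mathbb P\big(|y^\top Ay-\operatorname{Tr}(A\Phi)|\ge t\big)\le 2\exp\Big(-\tfrac1C\min\Big\{\tfrac{t^2}{4\lambda_\sigma^4\|X\|^4\|A\|_F^2},\tfrac{t}{\lambda_\sigma^2\|X\|^2\|A\|}\Big\}\Big);$$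 2. if $\mathbb E y\ne0$, then for all $t>0$ $$\begin{aligned}\mathbb P\big(|y^\top Ay-\operatorname{Tr}(A\Phi)|> t\big)&\le 2\exp\Big(-\tfrac1C\min\Big\{\tfrac{t^2}{8\lambda_\sigma^4\|X\|^4\|A\|_F^2},\tfrac{t}{\lambda_\sigma^2\|X\|^2\|A\|}\Big\}\Big)+2\exp\Big(-\tfrac{t^2}{32\lambda_\sigma^2\|X\|^2\|A\|^2\|\mathbb E y\|^2}\Big)\\&\le 2\exp\Big(-\tfrac1C\min\Big\{\tfrac{t^2}{8\lambda_\sigma^4\|X\|^4\|A\|_F^2},\tfrac{t}{\lambda_\sigma^2\|X\|^2\|A\|}\Big\}\Big)+2\exp\Big(-\tfrac{t^2}{32\lambda_\sigma^2\|X\|^2\|A\|^2\,t_0}\Big),\end{aligned}$$ where, with $\xi\sim\mathcal N(0,1)$, $$t_0=2\lambda_\sigma^2\sum_{i=1}^n(\|x_i\|-1)^2+2n\,(\mathbb E\sigma(\xi))^2;$$ 3. in all cases $\sigma(\xi)$ is integrable and $\|\mathbb E y\|^2\le t_0$. -/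

import Mathlib

open MeasureTheory ProbabilityTheory
open scoped NNReal

/-- The `K`-concentration property of a random vector `Z` in a finite-dimensional Euclidean space:
every `1`-Lipschitz function of `Z` is integrable and concentrates around its mean. -/
def HasConcentration {Ω : Type*} [MeasurableSpace Ω] (μ : Measure Ω) {d : ℕ}
    (Z : Ω → EuclideanSpace ℝ (Fin d)) (K : ℝ) : Prop :=
  ∀ f : EuclideanSpace ℝ (Fin d) → ℝ, LipschitzWith 1 f →
    Integrable (fun ω => f (Z ω)) μ ∧
      ∀ t : ℝ, 0 < t →
        μ.real {ω | t ≤ |f (Z ω) - ∫ ω', f (Z ω') ∂μ|} ≤ 2 * Real.exp (-(t ^ 2 / K ^ 2))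

/-- The spectral norm of a real matrix (operator norm between Euclidean spaces). -/
noncomputable def specNorm {m n : ℕ} (M : Matrix (Fin m) (Fin n) ℝ) : ℝ :=
  letI : NormedAddCommGroup (Matrix (Fin m) (Fin n) ℝ) := Matrix.instL2OpNormedAddCommGroup
  ‖M‖

/-- The Frobenius norm of a real matrix. -/
noncomputable def frobNorm {m n : ℕ} (M : Matrix (Fin m) (Fin n) ℝ) : ℝ :=
  letI : NormedAddCommGroup (Matrix (Fin m) (Fin n) ℝ) := Matrix.frobeniusNormedAddCommGroup
  ‖M‖

/-- The vector `σ(vᵀ X)ᵀ`, with `σ` applied entrywise. -/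
noncomputable def layer {d n : ℕ} (σ : ℝ → ℝ) (X : Matrix (Fin d) (Fin n) ℝ)
    (v : EuclideanSpace ℝ (Fin d)) : EuclideanSpace ℝ (Fin n) :=
  WithLp.toLp 2 (fun i => σ (Matrix.vecMul v.ofLp X i))

/-- The quadratic form `yᵀ A y`. -/
noncomputable def quadForm {n : ℕ} (A : Matrix (Fin n) (Fin n) ℝ)
    (y : EuclideanSpace ℝ (Fin n)) : ℝ :=
  y.ofLp ⬝ᵥ A.mulVec y.ofLp

/-- The second moment matrix `𝔼[y yᵀ]`. -/
noncomputable def secondMoment {Ω : Type*} [MeasurableSpace Ω] (μ : Measure Ω) {n : ℕ}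
    (y : Ω → EuclideanSpace ℝ (Fin n)) : Matrix (Fin n) (Fin n) ℝ :=
  Matrix.of (fun i j => ∫ ω, y ω i * y ω j ∂μ)

/-- `t₀ = 2 λ² ∑ᵢ (‖xᵢ‖ - 1)² + 2 n (𝔼 σ(ξ))²`, with `xᵢ` the columns of `X` and `ξ ∼ N(0,1)`. -/
noncomputable def tZero {d n : ℕ} (lam : ℝ) (σ : ℝ → ℝ) (X : Matrix (Fin d) (Fin n) ℝ) : ℝ :=
  2 * lam ^ 2 *
      ∑ i, (‖(WithLp.toLp 2 (fun k => X k i) : EuclideanSpace ℝ (Fin d))‖ - 1) ^ 2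
    + 2 * n * (∫ x, σ x ∂(gaussianReal 0 1)) ^ 2

/-! ### Spectral and Frobenius norms -/

/-! The map `layer σ X` is λ‖X‖-Lipschitz, so `y` inherits concentration with parameter Kλ‖X‖.
Everything then reduces to a Hanson–Wright inequality for a vector Z with the concentration property
(`HasConcentration.hansonWright`), since Tr(AΦ) is the mean of yᵀAy.

For centred Z, the form Q(z) = zᵀAz has gradient (A + Aᵀ)z, so it is r-Lipschitz where ‖(A + Aᵀ)z‖ ≤
r. That norm is itself a 2‖A‖-Lipschitz function of z, with mean at most 3K‖A‖_F, so Z leaves the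
region rarely once r = 3K‖A‖_F + 2√(‖A‖t). A Lipschitz extension of Q from the region concentrates
around its own mean, and so does Q up to the exit event. This centre depends on t through r.
`tail_of_exists_center` replaces it by the mean of Q: centres at different large scales must be
close because their events overlap, and integrating the tail places the mean near them.

If the mean m is nonzero, Q(Y) = Q(Y − m) + ⟨Y, (A + Aᵀ)m⟩ + const; the linear term is a Lipschitz
function of Y and yields the second exponential.

The Gaussian case needs only that a standard Gaussian has the concentration property. This is the
Maurey–Pisier argument: an independent copy is reached by a quarter turn, under which the pair keeps
its law, and Jensen's inequality along the turn reduces f(y) − f(x) to the directional derivative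
(π/2) Df(x)y, which is Gaussian for fixed x. -/

lemma specNorm_nonneg {m n : ℕ} (M : Matrix (Fin m) (Fin n) ℝ) : 0 ≤ specNorm M := by
  let _ : NormedAddCommGroup (Matrix (Fin m) (Fin n) ℝ) := Matrix.instL2OpNormedAddCommGroup
  exact norm_nonneg M

lemma frobNorm_nonneg {m n : ℕ} (M : Matrix (Fin m) (Fin n) ℝ) : 0 ≤ frobNorm M := by
  let _ : NormedAddCommGroup (Matrix (Fin m) (Fin n) ℝ) := Matrix.frobeniusNormedAddCommGroup
  exact norm_nonneg M

lemma specNorm_add_le {m n : ℕ} (M N : Matrix (Fin m) (Fin n) ℝ) :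
    specNorm (M + N) ≤ specNorm M + specNorm N := by
  let _ : NormedAddCommGroup (Matrix (Fin m) (Fin n) ℝ) := Matrix.instL2OpNormedAddCommGroup
  exact norm_add_le M N

lemma frobNorm_add_le {m n : ℕ} (M N : Matrix (Fin m) (Fin n) ℝ) :
    frobNorm (M + N) ≤ frobNorm M + frobNorm N := by
  let _ : NormedAddCommGroup (Matrix (Fin m) (Fin n) ℝ) := Matrix.frobeniusNormedAddCommGroup
  exact norm_add_le M N

lemma specNorm_transpose {m n : ℕ} (M : Matrix (Fin m) (Fin n) ℝ) :
    specNorm M.transpose = specNorm M := by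
  have := Matrix.l2_opNorm_conjTranspose M
  rwa [Matrix.conjTranspose_eq_transpose_of_trivial] at this

lemma frobNorm_sq {m n : ℕ} (M : Matrix (Fin m) (Fin n) ℝ) :
    frobNorm M ^ 2 = ∑ i, ∑ j, M i j ^ 2 := by
  have h : frobNorm M = (∑ i, ∑ j, ‖M i j‖ ^ (2 : ℝ)) ^ (1 / 2 : ℝ) :=
    Matrix.frobenius_norm_def M
  rw [h, ← Real.sqrt_eq_rpow, Real.sq_sqrt (by positivity)]
  simp

lemma frobNorm_transpose {m n : ℕ} (M : Matrix (Fin m) (Fin n) ℝ) :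
    frobNorm M.transpose = frobNorm M := by
  rw [← sq_eq_sq₀ (frobNorm_nonneg _) (frobNorm_nonneg _), frobNorm_sq, frobNorm_sq,
    Finset.sum_comm]
  rfl

lemma specNorm_add_transpose_le {n : ℕ} (A : Matrix (Fin n) (Fin n) ℝ) :
    specNorm (A + A.transpose) ≤ 2 * specNorm A :=
  (specNorm_add_le _ _).trans (by rw [specNorm_transpose]; linarith)

lemma frobNorm_add_transpose_le {n : ℕ} (A : Matrix (Fin n) (Fin n) ℝ) :
    frobNorm (A + A.transpose) ≤ 2 * frobNorm A :=
  (frobNorm_add_le _ _).trans (by rw [frobNorm_transpose]; linarith)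

lemma norm_toLp_mulVec_le {m n : ℕ} (M : Matrix (Fin m) (Fin n) ℝ)
    (x : EuclideanSpace ℝ (Fin n)) :
    ‖(WithLp.toLp 2 (M.mulVec x.ofLp) : EuclideanSpace ℝ (Fin m))‖ ≤ specNorm M * ‖x‖ :=
  Matrix.l2_opNorm_mulVec M x

lemma norm_toLp_mulVec_le_frobNorm {m n : ℕ} (M : Matrix (Fin m) (Fin n) ℝ)
    (x : EuclideanSpace ℝ (Fin n)) :
    ‖(WithLp.toLp 2 (M.mulVec x.ofLp) : EuclideanSpace ℝ (Fin m))‖ ≤ frobNorm M * ‖x‖ := by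
  apply (sq_le_sq₀ (norm_nonneg _) (mul_nonneg (frobNorm_nonneg M) (norm_nonneg x))).1
  rw [mul_pow, frobNorm_sq, EuclideanSpace.real_norm_sq_eq, EuclideanSpace.real_norm_sq_eq,
    Finset.sum_mul]
  exact Finset.sum_le_sum fun i _ => Finset.sum_mul_sq_le_sq_mul_sq Finset.univ (M i) x.ofLp

lemma lipschitzWith_toLp_mulVec {m n : ℕ} (M : Matrix (Fin m) (Fin n) ℝ) :
    LipschitzWith (specNorm M).toNNReal (fun x : EuclideanSpace ℝ (Fin n) =>
      (WithLp.toLp 2 (M.mulVec x.ofLp) : EuclideanSpace ℝ (Fin m))) := by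
  refine LipschitzWith.of_dist_le_mul fun x y => ?_
  rw [dist_eq_norm, dist_eq_norm, Real.coe_toNNReal _ (specNorm_nonneg M), ← WithLp.toLp_sub,
    ← Matrix.mulVec_sub]
  exact norm_toLp_mulVec_le M (x - y)

lemma specNorm_le_frobNorm {m n : ℕ} (M : Matrix (Fin m) (Fin n) ℝ) :
    specNorm M ≤ frobNorm M :=
  ContinuousLinearMap.opNorm_le_bound
    ((Matrix.toEuclideanLin (𝕜 := ℝ) (m := Fin m) (n := Fin n)).trans
      LinearMap.toContinuousLinearMap M) (frobNorm_nonneg M) (norm_toLp_mulVec_le_frobNorm M)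

/-! ### Quadratic forms and layers -/

lemma inner_toLp_mulVec {n : ℕ} (A : Matrix (Fin n) (Fin n) ℝ) (x y : EuclideanSpace ℝ (Fin n)) :
    inner ℝ x (WithLp.toLp 2 (A.mulVec y.ofLp) : EuclideanSpace ℝ (Fin n)) =
      x.ofLp ⬝ᵥ A.mulVec y.ofLp := by
  simp [PiLp.inner_apply, dotProduct, mul_comm]

lemma quadForm_add {n : ℕ} (A : Matrix (Fin n) (Fin n) ℝ) (x m : EuclideanSpace ℝ (Fin n)) :
    quadForm A (x + m) = quadForm A x +
      inner ℝ x (WithLp.toLp 2 ((A + A.transpose).mulVec m.ofLp) : EuclideanSpace ℝ (Fin n)) +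
      quadForm A m := by
  have h : m.ofLp ⬝ᵥ A.mulVec x.ofLp = x.ofLp ⬝ᵥ A.transpose.mulVec m.ofLp := by
    rw [Matrix.mulVec_transpose, Matrix.dotProduct_mulVec, dotProduct_comm]
  rw [inner_toLp_mulVec]
  simp only [quadForm, WithLp.ofLp_add, Matrix.mulVec_add, Matrix.add_mulVec, dotProduct_add,
    add_dotProduct, h]
  ring

/-- Polarisation gives the Lipschitz bound on a region where ‖(A + Aᵀ)z‖ is bounded, with no
integration along segments. Symmetrising is needed because A need not be symmetric. -/
lemma quadForm_sub_quadForm {n : ℕ} (A : Matrix (Fin n) (Fin n) ℝ)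
    (x y : EuclideanSpace ℝ (Fin n)) :
    quadForm A x - quadForm A y =
      inner ℝ (x - y) (WithLp.toLp 2 ((A + A.transpose).mulVec (x + y).ofLp) :
        EuclideanSpace ℝ (Fin n)) / 2 := by
  have h : y.ofLp ⬝ᵥ A.mulVec x.ofLp = x.ofLp ⬝ᵥ A.transpose.mulVec y.ofLp := by
    rw [Matrix.mulVec_transpose, Matrix.dotProduct_mulVec, dotProduct_comm]
  have h' : x.ofLp ⬝ᵥ A.mulVec y.ofLp = y.ofLp ⬝ᵥ A.transpose.mulVec x.ofLp := by
    rw [Matrix.mulVec_transpose, Matrix.dotProduct_mulVec, dotProduct_comm]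
  have hx : x.ofLp ⬝ᵥ A.mulVec x.ofLp = x.ofLp ⬝ᵥ A.transpose.mulVec x.ofLp := by
    rw [Matrix.mulVec_transpose, Matrix.dotProduct_mulVec, dotProduct_comm]
  have hy : y.ofLp ⬝ᵥ A.mulVec y.ofLp = y.ofLp ⬝ᵥ A.transpose.mulVec y.ofLp := by
    rw [Matrix.mulVec_transpose, Matrix.dotProduct_mulVec, dotProduct_comm]
  rw [inner_toLp_mulVec]
  simp only [quadForm, WithLp.ofLp_add, WithLp.ofLp_sub, Matrix.mulVec_add, Matrix.add_mulVec,
    dotProduct_add, sub_dotProduct, h, h', ← hx, ← hy]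
  ring

lemma quadForm_eq_sum {n : ℕ} (A : Matrix (Fin n) (Fin n) ℝ) (x : EuclideanSpace ℝ (Fin n)) :
    quadForm A x = ∑ i, ∑ j, A i j * (x j * x i) := by
  simp only [quadForm, dotProduct, Matrix.mulVec, Finset.mul_sum]
  exact Finset.sum_congr rfl fun i _ => Finset.sum_congr rfl fun j _ => by ring

lemma lipschitzWith_layer {d n : ℕ} {σ : ℝ → ℝ} {lam : ℝ≥0} (hσ : LipschitzWith lam σ)
    (X : Matrix (Fin d) (Fin n) ℝ) :
    LipschitzWith (lam * (specNorm X).toNNReal) (layer σ X) := by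
  refine LipschitzWith.of_dist_le_mul fun v v' => ?_
  have h1 : ‖layer σ X v - layer σ X v'‖ ≤
      lam * ‖(WithLp.toLp 2 (X.transpose.mulVec (v - v').ofLp) : EuclideanSpace ℝ (Fin n))‖ := by
    apply (sq_le_sq₀ (norm_nonneg _) (by positivity)).1
    rw [mul_pow, EuclideanSpace.real_norm_sq_eq, EuclideanSpace.real_norm_sq_eq, Finset.mul_sum]
    refine Finset.sum_le_sum fun i _ => ?_
    rw [← mul_pow, ← sq_abs, ← sq_abs (_ * _), abs_mul, NNReal.abs_eq]
    gcongr
    have := hσ.dist_le_mul (Matrix.vecMul v.ofLp X i) (Matrix.vecMul v'.ofLp X i)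
    simpa [Real.dist_eq, layer, Matrix.mulVec_transpose, Matrix.sub_vecMul] using this
  rw [dist_eq_norm, dist_eq_norm]
  refine h1.trans ?_
  rw [NNReal.coe_mul, Real.coe_toNNReal _ (specNorm_nonneg X), mul_assoc]
  gcongr
  simpa only [specNorm_transpose] using norm_toLp_mulVec_le X.transpose (v - v')

/-! ### Consequences of the concentration property -/

section Concentration

variable {Ω : Type*} [MeasurableSpace Ω] {μ : Measure Ω}

/-- Layer-cake formula: the tail integrates to c·b. -/
lemma integrable_and_integral_le_of_exp_tail [IsFiniteMeasure μ] {h : Ω → ℝ} (h0 : ∀ ω, 0 ≤ h ω)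
    (hm : AEMeasurable h μ) {b c : ℝ} (hb : 0 < b) (hc : 0 ≤ c)
    (ht : ∀ u : ℝ, 0 < u → μ.real {ω | u ≤ h ω} ≤ c * Real.exp (-(u / b))) :
    Integrable h μ ∧ ∫ ω, h ω ∂μ ≤ c * b := by
  have hneg : -b⁻¹ < 0 := by simpa using hb
  have hint : IntegrableOn (fun u : ℝ => c * Real.exp (-b⁻¹ * u)) (Set.Ioi 0) :=
    (integrableOn_exp_mul_Ioi hneg 0).const_mul c
  have hval : ∫ u in Set.Ioi (0 : ℝ), c * Real.exp (-b⁻¹ * u) = c * b := by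
    rw [integral_const_mul, integral_exp_mul_Ioi hneg]
    simp
  have hle : ∫⁻ ω, ENNReal.ofReal (h ω) ∂μ ≤ ENNReal.ofReal (c * b) := by
    rw [lintegral_eq_lintegral_meas_le μ (Filter.Eventually.of_forall h0) hm, ← hval,
      ofReal_integral_eq_lintegral_ofReal hint
        (Filter.Eventually.of_forall fun u => by positivity)]
    refine setLIntegral_mono' measurableSet_Ioi fun u hu => ?_
    rw [← ofReal_measureReal]
    refine ENNReal.ofReal_le_ofReal ((ht u hu).trans_eq ?_)
    congr 2
    field_simp
  have hI : Integrable h μ := by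
    refine ⟨hm.aestronglyMeasurable, ?_⟩
    rw [hasFiniteIntegral_iff_ofReal (Filter.Eventually.of_forall h0)]
    exact hle.trans_lt ENNReal.ofReal_lt_top
  refine ⟨hI, ?_⟩
  rw [integral_eq_lintegral_of_nonneg_ae (Filter.Eventually.of_forall h0) hI.1]
  exact ENNReal.toReal_le_of_le_ofReal (by positivity) hle

variable {d : ℕ} {Z : Ω → EuclideanSpace ℝ (Fin d)} {K : ℝ}

lemma HasConcentration.of_lipschitz (hZ : HasConcentration μ Z K) {L : ℝ≥0} (hL : 0 < L)
    {f : EuclideanSpace ℝ (Fin d) → ℝ} (hf : LipschitzWith L f) :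
    Integrable (fun ω => f (Z ω)) μ ∧
      ∀ t : ℝ, 0 < t → μ.real {ω | t ≤ |f (Z ω) - ∫ ω', f (Z ω') ∂μ|} ≤
        2 * Real.exp (-(t ^ 2 / (K * L) ^ 2)) := by
  have hL' : (0 : ℝ) < L := hL
  have hg : LipschitzWith 1 (fun x => (L : ℝ)⁻¹ * f x) := by
    refine LipschitzWith.of_dist_le_mul fun x y => ?_
    have := hf.dist_le_mul x y
    rw [Real.dist_eq] at this ⊢
    rw [← mul_sub, abs_mul, abs_of_pos (inv_pos.2 hL'), inv_mul_le_iff₀ hL']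
    simpa using this
  obtain ⟨h1, h2⟩ := hZ _ hg
  refine ⟨?_, fun t ht => ?_⟩
  · have := h1.const_mul (L : ℝ)
    simpa [← mul_assoc, hL'.ne'] using this
  · have := h2 (t / L) (by positivity)
    rw [integral_const_mul] at this
    have e : ∀ a b : ℝ, t / L ≤ |(L : ℝ)⁻¹ * a - (L : ℝ)⁻¹ * b| ↔ t ≤ |a - b| := fun a b => by
      rw [← mul_sub, abs_mul, abs_of_pos (inv_pos.2 hL'), div_le_iff₀ hL', mul_comm _ (L : ℝ),
        ← mul_assoc, mul_inv_cancel₀ hL'.ne', one_mul]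
    simp only [e] at this
    rwa [div_pow, div_div, ← mul_pow, mul_comm (L : ℝ)] at this

lemma HasConcentration.comp_lipschitz (hZ : HasConcentration μ Z K) {n : ℕ} {L : ℝ≥0}
    (hL : 0 < L) {φ : EuclideanSpace ℝ (Fin d) → EuclideanSpace ℝ (Fin n)}
    (hφ : LipschitzWith L φ) : HasConcentration μ (fun ω => φ (Z ω)) (K * L) := by
  intro f hf
  have h := hf.comp hφ
  rw [one_mul] at h
  exact hZ.of_lipschitz hL h

/-- The squared deviation has tail 2 exp(−u/(KL)²) in u, which integrates to 2(KL)². The case L = 0,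
where no rescaling to a 1-Lipschitz function is possible, is that of a constant. -/
lemma HasConcentration.integral_sq_sub_le [IsProbabilityMeasure μ] (hZ : HasConcentration μ Z K) (hK : 0 < K) {L : ℝ≥0}
    {f : EuclideanSpace ℝ (Fin d) → ℝ} (hf : LipschitzWith L f) :
    MemLp (fun ω => f (Z ω)) 2 μ ∧
      ∫ ω, (f (Z ω) - ∫ ω', f (Z ω') ∂μ) ^ 2 ∂μ ≤ 2 * (K * L) ^ 2 := by
  rcases eq_zero_or_pos L with rfl | hL
  · have hc : ∀ x, f x = f 0 := fun x => by
      have := hf.dist_le_mul x 0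
      rw [NNReal.coe_zero, zero_mul] at this
      exact dist_le_zero.1 this
    simp only [hc (Z _)]
    exact ⟨memLp_const _, by simp⟩
  have hL' : (0 : ℝ) < L := hL
  obtain ⟨h1, h2⟩ := hZ.of_lipschitz hL hf
  set m := ∫ ω, f (Z ω) ∂μ
  have hsub : AEStronglyMeasurable (fun ω => f (Z ω) - m) μ := h1.1.sub aestronglyMeasurable_const
  obtain ⟨h3, h4⟩ := integrable_and_integral_le_of_exp_tail (μ := μ)
    (h := fun ω => (f (Z ω) - m) ^ 2) (fun ω => sq_nonneg _) (hsub.pow 2).aemeasurable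
    (b := (K * L) ^ 2) (c := 2) (by positivity) (by norm_num) (fun u hu => by
      have := h2 (√u) (Real.sqrt_pos.2 hu)
      rw [Real.sq_sqrt hu.le] at this
      simpa only [Real.sqrt_le_left (abs_nonneg _), sq_abs] using this)
  refine ⟨?_, h4⟩
  have h5 : MemLp (fun ω => f (Z ω) - m) 2 μ := (memLp_two_iff_integrable_sq hsub).2 h3
  convert h5.add (memLp_const m) using 1
  ext ω
  simp

lemma HasConcentration.memLp_two [IsProbabilityMeasure μ] (hZ : HasConcentration μ Z K) (hK : 0 < K)
    (hm : AEMeasurable Z μ) : MemLp Z 2 μ :=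
  (memLp_norm_iff hm.aestronglyMeasurable).1
    (hZ.integral_sq_sub_le hK (lipschitzWith_one_norm (E := EuclideanSpace ℝ (Fin d)))).1

/-- This is where the Frobenius norm enters: each coordinate of BZ is centred and Lipschitz with the
norm of its row as constant, so the second moments add up to at most 2K²‖B‖_F². -/
lemma HasConcentration.integral_norm_mulVec_le [IsProbabilityMeasure μ]
    (hZ : HasConcentration μ Z K) (hK : 0 < K)
    (hZ0 : ∀ i, ∫ ω, Z ω i ∂μ = 0) {n : ℕ} (B : Matrix (Fin n) (Fin d) ℝ) :
    ∫ ω, ‖(WithLp.toLp 2 (B.mulVec (Z ω).ofLp) : EuclideanSpace ℝ (Fin n))‖ ∂μ ≤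
      3 / 2 * K * frobNorm B := by
  set g := fun ω => ‖(WithLp.toLp 2 (B.mulVec (Z ω).ofLp) : EuclideanSpace ℝ (Fin n))‖
  have hlip : ∀ i, LipschitzWith ‖(WithLp.toLp 2 (B i) : EuclideanSpace ℝ (Fin d))‖₊
      (fun x : EuclideanSpace ℝ (Fin d) => B.mulVec x.ofLp i) := fun i => by
    refine LipschitzWith.of_dist_le_mul fun x y => ?_
    rw [Real.dist_eq, dist_eq_norm, coe_nnnorm]
    convert abs_real_inner_le_norm (WithLp.toLp 2 (B i) : EuclideanSpace ℝ (Fin d)) (x - y) using 2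
    simp [Matrix.mulVec, dotProduct, PiLp.inner_apply, ← Finset.sum_sub_distrib]
    exact Finset.sum_congr rfl fun i _ => by ring
  have hint : ∀ i, Integrable (fun ω => Z ω i) μ := fun i =>
    (hZ _ ((EuclideanSpace.proj i : EuclideanSpace ℝ (Fin d) →L[ℝ] ℝ).lipschitz.weaken
      (ContinuousLinearMap.opNNNorm_le_bound _ _ fun x => by
        simpa using PiLp.nnnorm_apply_le x i))).1
  have hmean : ∀ i, ∫ ω, B.mulVec (Z ω).ofLp i ∂μ = 0 := fun i => by
    simp only [Matrix.mulVec, dotProduct]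
    rw [integral_finsetSum _ fun j _ => (hint j).const_mul _]
    simp [integral_const_mul, hZ0]
  have hsq : ∀ i, MemLp (fun ω => B.mulVec (Z ω).ofLp i) 2 μ ∧
      ∫ ω, (B.mulVec (Z ω).ofLp i) ^ 2 ∂μ ≤ 2 * K ^ 2 * ∑ j, B i j ^ 2 := fun i => by
    obtain ⟨h1, h2⟩ := hZ.integral_sq_sub_le hK (hlip i)
    refine ⟨h1, ?_⟩
    simp only [hmean i, sub_zero] at h2
    refine h2.trans_eq ?_
    rw [mul_pow, coe_nnnorm, EuclideanSpace.real_norm_sq_eq, mul_assoc]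
  have hg2 : ∀ ω, g ω ^ 2 = ∑ i, (B.mulVec (Z ω).ofLp i) ^ 2 := fun ω =>
    EuclideanSpace.real_norm_sq_eq _
  have hI2 : ∫ ω, g ω ^ 2 ∂μ ≤ 2 * K ^ 2 * frobNorm B ^ 2 := by
    simp only [hg2]
    rw [integral_finsetSum _ fun i _ => (hsq i).1.integrable_sq, frobNorm_sq, Finset.mul_sum]
    exact Finset.sum_le_sum fun i _ => (hsq i).2
  have hBlip : LipschitzWith (specNorm B).toNNReal (fun x : EuclideanSpace ℝ (Fin d) =>
      ‖(WithLp.toLp 2 (B.mulVec x.ofLp) : EuclideanSpace ℝ (Fin n))‖) := by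
    simpa using! lipschitzWith_one_norm.comp (lipschitzWith_toLp_mulVec B)
  have hgL : MemLp g 2 μ := (hZ.integral_sq_sub_le hK hBlip).1
  -- Nonnegative variance gives (𝔼g)² ≤ 𝔼g² ≤ 2K²‖B‖_F², and 2 ≤ (3/2)².
  have hvar := variance_nonneg g μ
  rw [variance_eq_sub hgL] at hvar
  have hF := frobNorm_nonneg B
  apply (abs_le_of_sq_le_sq' _ (by positivity)).2
  have : ∫ ω, (g ^ 2) ω ∂μ = ∫ ω, g ω ^ 2 ∂μ := rfl
  nlinarith [mul_nonneg (sq_nonneg K) (sq_nonneg (frobNorm B))]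

end Concentration

/-! ### The Hanson–Wright inequality for vectors with the concentration property -/

section HansonWright

lemma integrable_quadForm {Ω : Type*} [MeasurableSpace Ω] {μ : Measure Ω} {n : ℕ}
    {Y : Ω → EuclideanSpace ℝ (Fin n)} (hY : MemLp Y 2 μ)
    (A : Matrix (Fin n) (Fin n) ℝ) : Integrable (fun ω => quadForm A (Y ω)) μ := by
  simp only [quadForm_eq_sum]
  exact integrable_finsetSum _ fun i _ => integrable_finsetSum _ fun j _ =>
    ((hY.eval_piLp j).integrable_mul (hY.eval_piLp i)).const_mul _

variable {Ω : Type*} [MeasurableSpace Ω] {μ : Measure Ω} [IsProbabilityMeasure μ]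

/-- Two-sided tails around scale-dependent centres give tails around the mean. -/
lemma tail_of_exists_center {g : Ω → ℝ} (hg : Integrable g μ) {ψ : ℝ → ℝ} {τ : ℝ} (hτ : 0 < τ)
    (hψ : ∀ t, τ ≤ t → t / τ ≤ ψ t)
    (h : ∀ t, 0 < t → ∃ c, μ.real {ω | t ≤ |g ω - c|} ≤ 4 * Real.exp (-(ψ t / 36)))
    {t : ℝ} (ht : 108 * τ ≤ t) :
    μ.real {ω | 10 * t ≤ |g ω - ∫ ω', g ω' ∂μ|} ≤ 4 * Real.exp (-(ψ t / 36)) := by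
  -- The threshold 108 = 3 · 36 makes the exponent at least 3, and 4e⁻³ < 1/2: two such exceptional
  -- events cannot cover Ω.
  have hlt : ∀ t, 108 * τ ≤ t → 4 * Real.exp (-(ψ t / 36)) < 1 / 2 := fun t ht => by
    have h1 : 3 ≤ ψ t / 36 := by
      have := hψ t (by linarith)
      rw [le_div_iff₀ (by norm_num)]
      have h2 : 108 ≤ t / τ := by rwa [le_div_iff₀ hτ]
      linarith
    have h2 : Real.exp (-(ψ t / 36)) ≤ (Real.exp 1)⁻¹ ^ 3 := by
      rw [← Real.exp_neg, ← Real.exp_nat_mul]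
      exact Real.exp_le_exp.2 (by push_cast; linarith)
    have h3 : (Real.exp 1)⁻¹ < 1 / 2.7 := by
      rw [inv_eq_one_div]
      exact one_div_lt_one_div_of_lt (by norm_num) (by linarith [Real.exp_one_gt_d9])
    have h4 : (Real.exp 1)⁻¹ ^ 3 < (1 / 2.7) ^ 3 := pow_lt_pow_left₀ h3 (by positivity) (by norm_num)
    have h5 : ((1 : ℝ) / 2.7) ^ 3 < 1 / 8 := by norm_num
    linarith
  have ht0 : 0 < 108 * τ := by positivity
  obtain ⟨a, ha⟩ := h _ ht0
  -- centres at scales `t ≥ 108 τ` are within `2 t` of `a`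
  have hcen : ∀ t, 108 * τ ≤ t →
      μ.real {ω | 3 * t ≤ |g ω - a|} ≤ 4 * Real.exp (-(ψ t / 36)) := fun t ht => by
    obtain ⟨c, hc⟩ := h t (by linarith)
    have hca : |c - a| < t + 108 * τ := by
      by_contra! hcon
      have hcov : (Set.univ : Set Ω) ⊆
          {ω | t ≤ |g ω - c|} ∪ {ω | 108 * τ ≤ |g ω - a|} := fun ω _ => by
        by_contra! hω
        simp only [Set.mem_union, Set.mem_ofPred_eq, not_or, not_le] at hω
        have := abs_sub_le c (g ω) a
        rw [abs_sub_comm c (g ω)] at this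
        linarith [hω.1, hω.2]
      have h1 := (measureReal_mono hcov).trans (measureReal_union_le (μ := μ) _ _)
      rw [probReal_univ] at h1
      linarith [hlt t ht, hlt _ le_rfl]
    refine (measureReal_mono fun ω hω => ?_).trans hc
    simp only [Set.mem_ofPred_eq] at hω ⊢
    have := abs_sub_le (g ω) c a
    linarith
  -- The excess of |g − a| over 324τ = 3 · 108τ is integrated, using the tail at scale 108τ + u/3.
  -- Its mean is at most 4 · 108τ, so 𝔼|g − a| ≤ (4 + 3) · 108τ.
  obtain ⟨h1, h2⟩ := integrable_and_integral_le_of_exp_tail (μ := μ)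
    (h := fun ω => max (|g ω - a| - 324 * τ) 0) (fun ω => le_max_right _ _)
    (((hg.1.aemeasurable.sub_const a).abs.sub_const _).max aemeasurable_const)
    (b := 108 * τ) (c := 4) ht0 (by norm_num) (fun u hu => by
      have hset : {ω | u ≤ max (|g ω - a| - 324 * τ) 0} =
          {ω | 3 * (108 * τ + u / 3) ≤ |g ω - a|} := by
        ext ω
        simp only [Set.mem_ofPred_eq, le_max_iff, hu.not_ge, or_false]
        constructor <;> intro <;> linarith
      rw [hset]
      refine (hcen _ (by linarith)).trans ?_
      refine mul_le_mul_of_nonneg_left (Real.exp_le_exp.2 (neg_le_neg ?_)) (by norm_num)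
      have := hψ (108 * τ + u / 3) (by linarith)
      have e : (108 * τ + u / 3) / τ = 108 + 36 * (u / (108 * τ)) := by
        field_simp
        ring
      rw [le_div_iff₀ (by norm_num)]
      linarith)
  have hint : ∫ ω, |g ω - a| ∂μ ≤ 7 * (108 * τ) := by
    have h3 : ∫ ω, |g ω - a| ∂μ ≤ ∫ ω, (max (|g ω - a| - 324 * τ) 0 + 324 * τ) ∂μ := by
      refine integral_mono (hg.sub (integrable_const a)).abs (h1.add (integrable_const _))
        fun ω => ?_
      have := le_max_left (|g ω - a| - 324 * τ) 0
      simp only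
      linarith
    rw [integral_add h1 (integrable_const _), integral_const, probReal_univ, one_smul] at h3
    linarith
  have hmean : |∫ ω, g ω ∂μ - a| ≤ 7 * (108 * τ) := by
    have e : ∫ ω, g ω ∂μ - a = ∫ ω, (g ω - a) ∂μ := by
      rw [integral_sub hg (integrable_const _), integral_const, probReal_univ, one_smul]
    rw [e]
    exact (abs_integral_le_integral_abs).trans hint
  -- Since 7 · 108τ ≤ 7t, deviating by 10t from the mean forces a deviation of 3t from a.
  refine (measureReal_mono fun ω hω => ?_).trans (hcen t ht)
  simp only [Set.mem_ofPred_eq] at hω ⊢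
  have := abs_sub_le (g ω) a (∫ ω, g ω ∂μ)
  rw [abs_sub_comm a] at this
  linarith

variable {n : ℕ} {Z : Ω → EuclideanSpace ℝ (Fin n)} {K : ℝ}

lemma abs_quadForm_sub_le {A : Matrix (Fin n) (Fin n) ℝ} {r : ℝ} {x y : EuclideanSpace ℝ (Fin n)}
    (hx : ‖(WithLp.toLp 2 ((A + A.transpose).mulVec x.ofLp) : EuclideanSpace ℝ (Fin n))‖ ≤ r)
    (hy : ‖(WithLp.toLp 2 ((A + A.transpose).mulVec y.ofLp) : EuclideanSpace ℝ (Fin n))‖ ≤ r) :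
    |quadForm A x - quadForm A y| ≤ r * ‖x - y‖ := by
  rw [quadForm_sub_quadForm, abs_div, abs_two, div_le_iff₀ two_pos]
  refine (abs_real_inner_le_norm _ _).trans ?_
  rw [WithLp.ofLp_add, Matrix.mulVec_add, WithLp.toLp_add]
  have := norm_add_le (WithLp.toLp 2 ((A + A.transpose).mulVec x.ofLp) : EuclideanSpace ℝ (Fin n))
    (WithLp.toLp 2 ((A + A.transpose).mulVec y.ofLp))
  nlinarith [norm_nonneg (x - y)]

/-- Truncating to the region where the quadratic form is Lipschitz. -/
lemma HasConcentration.exists_center_quadForm (hZ : HasConcentration μ Z K) (hK : 0 < K)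
    (hZ0 : ∀ i, ∫ ω, Z ω i ∂μ = 0) {A : Matrix (Fin n) (Fin n) ℝ} (hA : 0 < specNorm A)
    {t : ℝ} (ht : 0 < t) :
    ∃ c, μ.real {ω | t ≤ |quadForm A (Z ω) - c|} ≤
      4 * Real.exp (-(min (t ^ 2 / (K ^ 4 * frobNorm A ^ 2)) (t / (K ^ 2 * specNorm A)) / 36)) := by
  set a := specNorm A
  set F := frobNorm A
  have hF : 0 < F := hA.trans_le (specNorm_le_frobNorm A)
  set B := A + A.transpose
  -- Chosen so that the exit exponent s²/(2Ka)² equals t/(K²a), the linear branch of the minimum.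
  set s := 2 * √(a * t)
  have hs : 0 < s := by positivity
  have hs2 : s ^ 2 = 4 * (a * t) := by
    rw [mul_pow, Real.sq_sqrt (by positivity)]
    norm_num
  set g : EuclideanSpace ℝ (Fin n) → ℝ := fun x =>
    ‖(WithLp.toLp 2 (B.mulVec x.ofLp) : EuclideanSpace ℝ (Fin n))‖
  have hglip : LipschitzWith (2 * a).toNNReal g := by
    have := lipschitzWith_one_norm.comp (lipschitzWith_toLp_mulVec B)
    rw [one_mul] at this
    exact this.weaken (Real.toNNReal_le_toNNReal (specNorm_add_transpose_le A))
  obtain ⟨hgi, hgt⟩ := hZ.of_lipschitz (Real.toNNReal_pos.2 (by positivity)) hglip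
  have hgm : ∫ ω, g (Z ω) ∂μ ≤ 3 * K * F := by
    refine (hZ.integral_norm_mulVec_le hK hZ0 B).trans ?_
    nlinarith [frobNorm_add_transpose_le A]
  set r := 3 * K * F + s
  have hr : 0 < r := by positivity
  have hlip : LipschitzOnWith r.toNNReal (quadForm A) {x | g x ≤ r} :=
    LipschitzOnWith.of_dist_le_mul fun x hx y hy => by
      rw [Real.dist_eq, dist_eq_norm, Real.coe_toNNReal _ hr.le]
      exact abs_quadForm_sub_le hx hy
  obtain ⟨f, hf, hfeq⟩ := hlip.extend_real
  obtain ⟨-, hft⟩ := hZ.of_lipschitz (Real.toNNReal_pos.2 hr) hf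
  refine ⟨∫ ω, f (Z ω) ∂μ, ?_⟩
  have hsub : {ω | t ≤ |quadForm A (Z ω) - ∫ ω, f (Z ω) ∂μ|} ⊆
      {ω | t ≤ |f (Z ω) - ∫ ω, f (Z ω) ∂μ|} ∪ {ω | s ≤ |g (Z ω) - ∫ ω, g (Z ω) ∂μ|} :=
    fun ω hω => by
      by_cases hD : g (Z ω) ≤ r
      · left
        simpa only [Set.mem_ofPred_eq, ← hfeq hD] using hω
      · right
        change s ≤ |g (Z ω) - ∫ ω, g (Z ω) ∂μ|
        refine le_trans ?_ (le_abs_self _)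
        simp only [r, not_le] at hD
        linarith
  refine (measureReal_mono hsub).trans ((measureReal_union_le _ _).trans ?_)
  have h1 := hft t ht
  have h2 := hgt s hs
  rw [Real.coe_toNNReal _ hr.le] at h1
  rw [Real.coe_toNNReal _ (by positivity)] at h2
  set m := min (t ^ 2 / (K ^ 4 * F ^ 2)) (t / (K ^ 2 * a))
  have hm1 : m * (K ^ 4 * F ^ 2) ≤ t ^ 2 := (le_div_iff₀ (by positivity)).1 (min_le_left _ _)
  have hm2 : m * (K ^ 2 * a) ≤ t := (le_div_iff₀ (by positivity)).1 (min_le_right _ _)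
  have hm0 : 0 < m := by positivity
  -- With r² ≤ 2(3KF)² + 2s², the two bounds on m give m(Kr)² ≤ (18 + 8)t² ≤ 36t².
  have e1 : m / 36 ≤ t ^ 2 / (K * r) ^ 2 := by
    rw [le_div_iff₀ (by positivity)]
    have hr2 : r ^ 2 ≤ 18 * (K ^ 2 * F ^ 2) + 8 * (a * t) := by
      simp only [r]
      nlinarith [sq_nonneg (3 * K * F - s)]
    have : m / 36 * (K * r) ^ 2 ≤ m / 36 * (K ^ 2 * (18 * (K ^ 2 * F ^ 2) + 8 * (a * t))) := by
      rw [mul_pow]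
      gcongr
    nlinarith [mul_le_mul_of_nonneg_right hm2 ht.le]
  have e2 : m / 36 ≤ s ^ 2 / (K * (2 * a)) ^ 2 := by
    rw [hs2, le_div_iff₀ (by positivity)]
    nlinarith [mul_le_mul_of_nonneg_right hm2 hA.le]
  have e3 := Real.exp_le_exp.2 (neg_le_neg e1)
  have e4 := Real.exp_le_exp.2 (neg_le_neg e2)
  linarith

lemma two_mul_exp_neg_ge_one {x : ℝ} (hx : x ≤ 1 / 2) : 1 ≤ 2 * Real.exp (-x) := by
  linarith [Real.add_one_le_exp (-x)]

/-- **Hanson–Wright inequality** for a centred vector with the concentration property. -/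
theorem HasConcentration.hansonWright (hZ : HasConcentration μ Z K) (hK : 0 < K)
    (hm : AEMeasurable Z μ) (hZ0 : ∀ i, ∫ ω, Z ω i ∂μ = 0) (A : Matrix (Fin n) (Fin n) ℝ)
    {t : ℝ} (ht : 0 < t) :
    μ.real {ω | t ≤ |quadForm A (Z ω) - ∫ ω', quadForm A (Z ω') ∂μ|} ≤
      2 * Real.exp (-(min (t ^ 2 / (K ^ 4 * frobNorm A ^ 2)) (t / (K ^ 2 * specNorm A)) /
        2400000)) := by
  set ψ : ℝ → ℝ := fun t => min (t ^ 2 / (K ^ 4 * frobNorm A ^ 2)) (t / (K ^ 2 * specNorm A))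
  change _ ≤ 2 * Real.exp (-(ψ t / 2400000))
  -- Below this level the exponent is at most 1/2 and the claimed bound exceeds 1. This also
  -- disposes of ‖A‖ = 0, where division by zero makes the minimum at most 0.
  by_cases hsmall : ψ t ≤ 1200000
  · exact measureReal_le_one.trans (two_mul_exp_neg_ge_one (by linarith))
  push Not at hsmall
  have hA : 0 < specNorm A := by
    refine (specNorm_nonneg A).lt_of_ne fun h => ?_
    simp only [ψ, ← h, mul_zero, div_zero] at hsmall
    have := min_le_right (t ^ 2 / (K ^ 4 * frobNorm A ^ 2)) 0
    linarith
  have hF : 0 < frobNorm A := hA.trans_le (specNorm_le_frobNorm A)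
  set τ := K ^ 2 * frobNorm A
  have hτ : 0 < τ := by positivity
  have hτ2 : K ^ 4 * frobNorm A ^ 2 = τ ^ 2 := by simp only [τ]; ring
  have hψ : ∀ t, τ ≤ t → t / τ ≤ ψ t := fun t ht => by
    have ht0 : 0 < t := hτ.trans_le ht
    refine le_min ?_ ?_
    · rw [hτ2, div_le_div_iff₀ hτ (by positivity)]
      nlinarith [mul_pos ht0 hτ]
    · simp only [τ]
      gcongr
      exact specNorm_le_frobNorm A
  have hint := integrable_quadForm (hZ.memLp_two hK hm) A
  -- Otherwise ψ t ≤ 1080² < 1200000. Thus t/10 lies above the threshold 108τ.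
  have ht1 : 1080 * τ ≤ t := by
    by_contra! hcon
    have h1 : ψ t ≤ t ^ 2 / τ ^ 2 := (min_le_left _ _).trans_eq (by rw [hτ2])
    have h2 : t ^ 2 / τ ^ 2 ≤ 1080 ^ 2 := by
      rw [← div_pow]
      exact pow_le_pow_left₀ (by positivity) ((div_le_iff₀ hτ).2 hcon.le) 2
    linarith
  have key := tail_of_exists_center hint hτ hψ
    (fun t ht => hZ.exists_center_quadForm hK hZ0 hA ht) (t := t / 10) (by linarith)
  rw [mul_div_cancel₀ _ (by norm_num : (10 : ℝ) ≠ 0)] at key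
  refine key.trans ?_
  have h10 : ψ t / 100 ≤ ψ (t / 10) := by
    refine le_min ?_ ?_
    · refine (div_le_div_of_nonneg_right (min_le_left _ _) (by norm_num)).trans_eq ?_
      ring
    · have h0 : 0 ≤ t / (K ^ 2 * specNorm A) := by positivity
      have h1 : ψ t ≤ t / (K ^ 2 * specNorm A) := min_le_right _ _
      rw [div_right_comm]
      linarith
  have h2 : (2 : ℝ) ≤ Real.exp 1 := by linarith [Real.exp_one_gt_d9]
  -- The exponent is at least ψ t / 3600; as ψ t is large, one unit of it can be spent on lowering
  -- the prefactor from 4 to 2.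
  calc 4 * Real.exp (-(ψ (t / 10) / 36)) ≤ 4 * Real.exp (-(ψ t / 2400000) + -1) := by
        gcongr
        linarith
    _ = 2 * Real.exp (-(ψ t / 2400000)) * (2 * (Real.exp 1)⁻¹) := by
        rw [Real.exp_add, Real.exp_neg 1]
        ring
    _ ≤ 2 * Real.exp (-(ψ t / 2400000)) * 1 := by
        gcongr
        rw [← div_eq_mul_inv, div_le_one (by positivity)]
        exact h2
    _ = _ := mul_one _

end HansonWright

/-! ### Gaussian concentration of Lipschitz functions -/

section Gaussian

open Filter Topology

lemma pi_gaussianReal_absolutelyContinuous (d : ℕ) :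
    Measure.pi (fun _ : Fin d => gaussianReal 0 1) ≪ (volume : Measure (Fin d → ℝ)) := by
  rw [volume_pi]
  induction d with
  | zero => rw [Measure.pi_of_empty, Measure.pi_of_empty]
  | succ d ih =>
    have h1 := measurePreserving_piFinSuccAbove (fun _ : Fin (d + 1) => gaussianReal 0 1) 0
    have h2 := measurePreserving_piFinSuccAbove (fun _ : Fin (d + 1) => (volume : Measure ℝ)) 0
    rw [← h1.symm.map_eq, ← h2.symm.map_eq]
    exact ((gaussianReal_absolutelyContinuous 0 one_ne_zero).prod ih).map
      (MeasurableEquiv.measurable _)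

/-- Transfers Rademacher's theorem, which holds Lebesgue-almost everywhere, to the Gaussian measure.
-/
lemma stdGaussian_absolutelyContinuous (d : ℕ) :
    stdGaussian (EuclideanSpace ℝ (Fin d)) ≪ volume := by
  rw [← map_pi_eq_stdGaussian, ← (PiLp.volume_preserving_toLp (Fin d)).map_eq]
  exact (pi_gaussianReal_absolutelyContinuous d).map (PiLp.volume_preserving_toLp _).measurable

/-- Fernique's theorem, with c‖x‖ ≤ C‖x‖² + c²/(4C). -/
lemma ProbabilityTheory.IsGaussian.integrable_exp_mul_norm {E : Type*} [NormedAddCommGroup E]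
    [NormedSpace ℝ E] [CompleteSpace E] [SecondCountableTopology E] [MeasurableSpace E]
    [BorelSpace E] (γ : Measure E) [IsGaussian γ] (c : ℝ) :
    Integrable (fun x => Real.exp (c * ‖x‖)) γ := by
  obtain ⟨C, hC, hI⟩ := IsGaussian.exists_integrable_exp_sq γ
  refine (hI.const_mul (Real.exp (c ^ 2 / (4 * C)))).mono'
    (by fun_prop) (Eventually.of_forall fun x => ?_)
  rw [Real.norm_of_nonneg (Real.exp_pos _).le, ← Real.exp_add, Real.exp_le_exp]
  have h : c ^ 2 / (4 * C) + C * ‖x‖ ^ 2 - c * ‖x‖ = (c / (2 * C) - ‖x‖) ^ 2 * C := by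
    field_simp
    ring
  have := mul_nonneg (sq_nonneg (c / (2 * C) - ‖x‖)) hC.le
  linarith

lemma integral_exp_strongDual_stdGaussian {E : Type*} [NormedAddCommGroup E]
    [InnerProductSpace ℝ E] [FiniteDimensional ℝ E] [MeasurableSpace E] [BorelSpace E]
    (L : StrongDual ℝ E) (s : ℝ) :
    ∫ y, Real.exp (s * L y) ∂(stdGaussian E) = Real.exp (s ^ 2 * ‖L‖ ^ 2 / 2) := by
  have h := mgf_gaussianReal (IsGaussian.map_eq_gaussianReal (μ := stdGaussian E) L) s
  rw [mgf] at h
  rw [h, integral_strongDual_stdGaussian, variance_dual_stdGaussian,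
    Real.coe_toNNReal _ (sq_nonneg _)]
  congr 1
  ring

lemma rotation_rotation {E : Type*} [NormedAddCommGroup E] [NormedSpace ℝ E] (θ δ : ℝ)
    (p : E × E) : ContinuousLinearMap.rotation δ (ContinuousLinearMap.rotation θ p) =
      ContinuousLinearMap.rotation (θ + δ) p := by
  simp only [ContinuousLinearMap.rotation_apply, Real.cos_add, Real.sin_add]
  ext <;> simp <;> module

variable {d : ℕ} {f : EuclideanSpace ℝ (Fin d) → ℝ}

local notation "𝔼" => EuclideanSpace ℝ (Fin d)
local notation "γ" => stdGaussian (EuclideanSpace ℝ (Fin d))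

lemma measurePreserving_rotation_stdGaussian (θ : ℝ) :
    MeasurePreserving (ContinuousLinearMap.rotation (E := 𝔼) θ) ((γ).prod γ) ((γ).prod γ) :=
  ⟨by fun_prop, IsGaussian.map_rotation_eq_self integral_id_stdGaussian θ⟩

lemma abs_rotation_increment_le (hf : LipschitzWith 1 f) {δ : ℝ} (hδ : 0 ≤ δ) (p : 𝔼 × 𝔼) :
    |f (ContinuousLinearMap.rotation δ p).1 - f p.1| ≤ δ * (‖p.1‖ + ‖p.2‖) := by
  have h1 := hf.dist_le_mul (ContinuousLinearMap.rotation δ p).1 p.1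
  rw [Real.dist_eq, NNReal.coe_one, one_mul, dist_eq_norm] at h1
  refine h1.trans ?_
  have h2 : (ContinuousLinearMap.rotation δ p).1 - p.1 =
      (Real.cos δ - 1) • p.1 + Real.sin δ • p.2 := by
    rw [ContinuousLinearMap.rotation_apply]
    module
  rw [h2, mul_add]
  refine (norm_add_le _ _).trans ?_
  rw [norm_smul, norm_smul, Real.norm_eq_abs, Real.norm_eq_abs]
  gcongr
  · simpa [abs_of_nonneg hδ] using Real.abs_cos_sub_cos_le δ 0
  · simpa [abs_of_nonneg hδ] using Real.abs_sin_le_abs (x := δ)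

lemma integrable_exp_of_abs_le_norm_add {F : 𝔼 × 𝔼 → ℝ} (c : ℝ)
    (hF : AEStronglyMeasurable F ((γ).prod γ))
    (h : ∀ᵐ p ∂((γ).prod γ), |F p| ≤ c * (‖p.1‖ + ‖p.2‖)) :
    Integrable (fun p => Real.exp (F p)) ((γ).prod γ) := by
  have hI : Integrable (fun p : 𝔼 × 𝔼 => Real.exp (c * ‖p.1‖) * Real.exp (c * ‖p.2‖))
      ((γ).prod γ) :=
    (IsGaussian.integrable_exp_mul_norm γ c).mul_prod (IsGaussian.integrable_exp_mul_norm γ c)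
  refine hI.mono' (Real.continuous_exp.comp_aestronglyMeasurable hF) ?_
  filter_upwards [h] with p hp
  rw [Real.norm_of_nonneg (Real.exp_pos _).le, ← Real.exp_add, ← mul_add, Real.exp_le_exp]
  exact (le_abs_self _).trans hp

/-- Cutting the quarter turn from `x` to `y` into `N` equal rotations. -/
lemma integral_exp_sub_le_rotation (hf : LipschitzWith 1 f) (s : ℝ) {N : ℕ} (hN : 0 < N) :
    ∫ p, Real.exp (s * (f p.2 - f p.1)) ∂((γ).prod γ) ≤
      ∫ p, Real.exp (s * (N * (f (ContinuousLinearMap.rotation (Real.pi / 2 / N) p).1 - f p.1)))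
        ∂((γ).prod γ) := by
  have hN' : (0 : ℝ) < N := by exact_mod_cast hN
  have hfc := hf.continuous
  set δ := Real.pi / 2 / N
  have hδ : 0 ≤ δ := by have := Real.pi_pos; positivity
  set G : 𝔼 × 𝔼 → ℝ := fun p => N * (f (ContinuousLinearMap.rotation δ p).1 - f p.1)
  have hG : Continuous G := by fun_prop
  have hGi : Integrable (fun p => Real.exp (s * G p)) ((γ).prod γ) := by
    refine integrable_exp_of_abs_le_norm_add (|s| * (N * δ)) (by fun_prop)
      (Eventually.of_forall fun p => ?_)
    rw [abs_mul, mul_assoc]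
    gcongr
    rw [abs_mul, Nat.abs_cast, mul_assoc]
    gcongr
    exact abs_rotation_increment_le hf hδ p
  -- Rotation invariance: every increment of the turn has the law of the first.
  have hGk : ∀ k : ℕ, Integrable (fun p => Real.exp (s *
      G (ContinuousLinearMap.rotation (k * δ) p))) ((γ).prod γ) ∧
      ∫ p, Real.exp (s * G (ContinuousLinearMap.rotation (k * δ) p)) ∂((γ).prod γ) =
        ∫ p, Real.exp (s * G p) ∂((γ).prod γ) := fun k => by
    have hmp := measurePreserving_rotation_stdGaussian (d := d) (k * δ)
    refine ⟨hmp.integrable_comp_of_integrable hGi, ?_⟩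
    conv_rhs => rw [← hmp.map_eq]
    rw [integral_map hmp.measurable.aemeasurable (by fun_prop)]
  have hpt : ∀ p : 𝔼 × 𝔼, Real.exp (s * (f p.2 - f p.1)) ≤
      ∑ k ∈ Finset.range N, (N : ℝ)⁻¹ * Real.exp (s *
        G (ContinuousLinearMap.rotation (k * δ) p)) := fun p => by
    -- The difference f(y) − f(x) telescopes into the average of the N rescaled increments, so
    -- Jensen's inequality applies.
    have hconv := convexOn_exp.map_sum_le (t := Finset.range N) (w := fun _ => (N : ℝ)⁻¹)
      (p := fun k : ℕ => s * G (ContinuousLinearMap.rotation (k * δ) p))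
      (fun _ _ => by positivity) (by simp [hN'.ne']) (fun _ _ => Set.mem_univ _)
    simp only [smul_eq_mul] at hconv
    refine le_of_eq_of_le (congrArg Real.exp ?_) hconv
    have htel := Finset.sum_range_sub
      (fun k : ℕ => f (ContinuousLinearMap.rotation (k * δ) p).1) N
    have hNδ : N * δ = Real.pi / 2 := by
      simp only [δ]
      field_simp
    have e1 : (ContinuousLinearMap.rotation (N * δ) p).1 = p.2 := by
      rw [hNδ, ContinuousLinearMap.rotation_apply]
      simp
    have e0 : (ContinuousLinearMap.rotation (((0 : ℕ) : ℝ) * δ) p).1 = p.1 := by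
      rw [ContinuousLinearMap.rotation_apply]
      simp
    rw [e1, e0] at htel
    rw [← htel, Finset.mul_sum]
    refine Finset.sum_congr rfl fun k _ => ?_
    simp only [G, rotation_rotation]
    push_cast
    rw [add_mul, one_mul]
    field_simp
  calc ∫ p, Real.exp (s * (f p.2 - f p.1)) ∂((γ).prod γ)
      ≤ ∫ p, ∑ k ∈ Finset.range N, (N : ℝ)⁻¹ * Real.exp (s *
        G (ContinuousLinearMap.rotation (k * δ) p)) ∂((γ).prod γ) :=
        integral_mono_of_nonneg (Eventually.of_forall fun p => (Real.exp_pos _).le)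
          (integrable_finsetSum _ fun k _ => (hGk k).1.const_mul _) (Eventually.of_forall hpt)
    _ = ∫ p, Real.exp (s * G p) ∂((γ).prod γ) := by
        rw [integral_finsetSum _ fun k _ => (hGk k).1.const_mul _]
        simp only [integral_const_mul, (hGk _).2]
        rw [Finset.sum_const, Finset.card_range, nsmul_eq_mul, ← mul_assoc,
          mul_inv_cancel₀ hN'.ne', one_mul]

lemma tendsto_rotation_increment {x : 𝔼} (hf : DifferentiableAt ℝ f x) (y : 𝔼) :
    Tendsto (fun N : ℕ => N * (f (ContinuousLinearMap.rotation (Real.pi / 2 / N) (x, y)).1 - f x))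
      atTop (𝓝 (Real.pi / 2 * fderiv ℝ f x y)) := by
  have hcurve : HasDerivAt (fun θ : ℝ => (ContinuousLinearMap.rotation θ (x, y)).1) y 0 := by
    have h := ((Real.hasDerivAt_cos 0).smul_const x).add ((Real.hasDerivAt_sin 0).smul_const y)
    simpa [ContinuousLinearMap.rotation_apply] using! h
  have h0 : (ContinuousLinearMap.rotation (0 : ℝ) (x, y)).1 = x := by
    simp [ContinuousLinearMap.rotation_apply]
  have hfx : HasFDerivAt f (fderiv ℝ f x) ((ContinuousLinearMap.rotation (0 : ℝ) (x, y)).1) := by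
    rw [h0]
    exact hf.hasFDerivAt
  have h := hfx.comp_hasDerivAt (0 : ℝ) hcurve
  have hs := hasDerivAt_iff_tendsto_slope_zero.1 h
  have hpi : (0 : ℝ) < Real.pi / 2 := by have := Real.pi_pos; positivity
  have hδ : Tendsto (fun N : ℕ => Real.pi / 2 / (N : ℝ)) atTop (𝓝[≠] 0) := by
    rw [tendsto_nhdsWithin_iff]
    refine ⟨tendsto_const_div_atTop_nhds_zero_nat _, ?_⟩
    filter_upwards [eventually_gt_atTop 0] with N hN
    have : (0 : ℝ) < N := by exact_mod_cast hN
    exact (div_pos hpi this).ne'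
  refine ((hs.comp hδ).const_mul (Real.pi / 2)).congr' ?_
  filter_upwards [eventually_gt_atTop 0] with N hN
  have : (0 : ℝ) < N := by exact_mod_cast hN
  simp only [Function.comp_apply, zero_add, h0, smul_eq_mul]
  rw [inv_div, ← mul_assoc]
  congr 1
  field_simp

lemma integral_exp_sub_le (hf : LipschitzWith 1 f) (s : ℝ) :
    ∫ p, Real.exp (s * (f p.2 - f p.1)) ∂((γ).prod γ) ≤
      Real.exp (s ^ 2 * (Real.pi / 2) ^ 2 / 2) := by
  have hpi : (0 : ℝ) < Real.pi / 2 := by have := Real.pi_pos; positivity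
  have hfc := hf.continuous
  have hdiff : ∀ᵐ p ∂((γ).prod γ), DifferentiableAt ℝ f p.1 :=
    Measure.quasiMeasurePreserving_fst.ae
      ((stdGaussian_absolutelyContinuous d).ae_le hf.ae_differentiableAt)
  set G : ℕ → 𝔼 × 𝔼 → ℝ := fun N p =>
    N * (f (ContinuousLinearMap.rotation (Real.pi / 2 / N) p).1 - f p.1)
  have hG : ∀ N, Continuous (G N) := fun N => by fun_prop
  -- The factor N cancels the step π/(2N), giving a dominating function independent of N. For N = 0
  -- the increment vanishes.
  have hGle : ∀ N p, |s * G N p| ≤ |s| * (Real.pi / 2) * (‖p.1‖ + ‖p.2‖) := fun N p => by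
    rw [abs_mul, mul_assoc]
    gcongr
    rcases Nat.eq_zero_or_pos N with rfl | hN
    · simp only [G, Nat.cast_zero, zero_mul, abs_zero]
      positivity
    have hN' : (0 : ℝ) < N := by exact_mod_cast hN
    rw [abs_mul, Nat.abs_cast]
    calc _ ≤ N * (Real.pi / 2 / N * (‖p.1‖ + ‖p.2‖)) := by
          gcongr
          exact abs_rotation_increment_le hf (by positivity) p
      _ = _ := by field_simp
  set D : 𝔼 × 𝔼 → ℝ := fun p => Real.pi / 2 * fderiv ℝ f p.1 p.2
  have hlim : ∀ᵐ p ∂((γ).prod γ), Tendsto (fun N => Real.exp (s * G N p)) atTop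
      (𝓝 (Real.exp (s * D p))) := by
    filter_upwards [hdiff] with p hp
    exact (Real.continuous_exp.tendsto _).comp
      ((tendsto_rotation_increment hp p.2).const_mul s)
  have hbd : Integrable (fun p : 𝔼 × 𝔼 =>
      Real.exp (|s| * (Real.pi / 2) * (‖p.1‖ + ‖p.2‖))) ((γ).prod γ) :=
    integrable_exp_of_abs_le_norm_add (|s| * (Real.pi / 2)) (by fun_prop)
      (Eventually.of_forall fun p => (abs_of_nonneg (by positivity)).le)
  have hT := tendsto_integral_of_dominated_convergence _ (fun N => by fun_prop) hbd
    (fun N => Eventually.of_forall fun p => by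
      rw [Real.norm_of_nonneg (Real.exp_pos _).le, Real.exp_le_exp]
      exact (le_abs_self _).trans (hGle N p)) hlim
  have hnorm : ∀ x, ‖fderiv ℝ f x‖ ≤ 1 := fun x => by
    simpa using norm_fderiv_le_of_lipschitz ℝ hf
  have hDm : Measurable D := by
    have : Measurable fun p : 𝔼 × 𝔼 => fderiv ℝ f p.1 p.2 :=
      (isBoundedBilinearMap_apply (𝕜 := ℝ) (E := 𝔼) (F := ℝ)).continuous.measurable.comp
        (((measurable_fderiv ℝ f).comp measurable_fst).prodMk measurable_snd)
    exact this.const_mul _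
  have hDi : Integrable (fun p => Real.exp (s * D p)) ((γ).prod γ) := by
    refine integrable_exp_of_abs_le_norm_add (|s| * (Real.pi / 2))
      (hDm.const_mul s).aestronglyMeasurable (Eventually.of_forall fun p => ?_)
    rw [abs_mul, abs_mul, abs_of_pos hpi, mul_assoc]
    gcongr
    have h1 := (fderiv ℝ f p.1).le_of_opNorm_le (hnorm p.1) p.2
    rw [Real.norm_eq_abs] at h1
    linarith [norm_nonneg p.1]
  refine (ge_of_tendsto hT ?_).trans ?_
  · filter_upwards [eventually_gt_atTop 0] with N hN
    exact integral_exp_sub_le_rotation hf s hN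
  rw [integral_prod _ hDi]
  -- For fixed x the derivative is a linear functional of norm at most 1 of the Gaussian y, so its
  -- exponential moment is explicit.
  have hin : ∀ x : 𝔼, ∫ y, Real.exp (s * D (x, y)) ∂γ ≤
      Real.exp (s ^ 2 * (Real.pi / 2) ^ 2 / 2) := fun x => by
    simp only [D, ← mul_assoc]
    rw [integral_exp_strongDual_stdGaussian, Real.exp_le_exp, mul_pow]
    have : ‖fderiv ℝ f x‖ ^ 2 ≤ 1 := pow_le_one₀ (norm_nonneg _) (hnorm x)
    nlinarith [mul_nonneg (sq_nonneg s) (sq_nonneg (Real.pi / 2))]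
  calc ∫ x, ∫ y, Real.exp (s * D (x, y)) ∂γ ∂γ
      ≤ ∫ _, Real.exp (s ^ 2 * (Real.pi / 2) ^ 2 / 2) ∂γ :=
        integral_mono hDi.integral_prod_left (integrable_const _) hin
    _ = _ := by simp

lemma LipschitzWith.integrable_exp_stdGaussian (hf : LipschitzWith 1 f) (s : ℝ) :
    Integrable (fun x => Real.exp (s * f x)) γ := by
  have hfc := hf.continuous
  refine ((IsGaussian.integrable_exp_mul_norm γ |s|).const_mul (Real.exp (|s| * |f 0|))).mono'
    (by fun_prop) (Eventually.of_forall fun x => ?_)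
  rw [Real.norm_of_nonneg (Real.exp_pos _).le, ← Real.exp_add, Real.exp_le_exp, ← mul_add]
  refine (le_abs_self _).trans ?_
  rw [abs_mul]
  gcongr
  have h := hf.dist_le_mul x 0
  rw [Real.dist_eq, dist_zero_right, NNReal.coe_one, one_mul] at h
  linarith [abs_sub_abs_le_abs_sub (f x) (f 0)]

lemma LipschitzWith.integrable_stdGaussian {L : ℝ≥0} (hf : LipschitzWith L f) :
    Integrable f γ := by
  have hfc := hf.continuous
  have hid : Integrable (fun x : 𝔼 => ‖x‖) γ := IsGaussian.integrable_id.norm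
  refine ((integrable_const |f 0|).add (hid.const_mul L)).mono' (by fun_prop)
    (Eventually.of_forall fun x => ?_)
  have h := hf.dist_le_mul x 0
  rw [Real.dist_eq, dist_zero_right] at h
  rw [Real.norm_eq_abs]
  simp only [Pi.add_apply]
  linarith [abs_sub_abs_le_abs_sub (f x) (f 0)]

/-- The Maurey–Pisier inequality. -/
lemma LipschitzWith.hasSubgaussianMGF_stdGaussian (hf : LipschitzWith 1 f) :
    HasSubgaussianMGF (fun x => f x - ∫ x', f x' ∂γ) (Real.toNNReal ((Real.pi / 2) ^ 2)) γ := by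
  set m := ∫ x, f x ∂γ
  have hint : ∀ s : ℝ, Integrable (fun x => Real.exp (s * (f x - m))) γ := fun s => by
    have := (hf.integrable_exp_stdGaussian s).mul_const (Real.exp (-(s * m)))
    simpa only [← Real.exp_add, mul_sub, ← sub_eq_add_neg] using this
  have hI : Integrable (fun x => f x - m) γ :=
    hf.integrable_stdGaussian.sub (integrable_const m)
  refine ⟨hint, fun s => ?_⟩
  -- Jensen's inequality for the independent copy, which may then be inserted as a factor at least
  -- 1.
  have h1 : 1 ≤ ∫ x, Real.exp (-s * (f x - m)) ∂γ := by
    have hle : ∫ x, (-s * (f x - m) + 1) ∂γ ≤ ∫ x, Real.exp (-s * (f x - m)) ∂γ :=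
      integral_mono ((hI.const_mul _).add (integrable_const 1)) (hint (-s)) fun x => Real.add_one_le_exp _
    rw [integral_add (hI.const_mul _) (integrable_const 1), integral_const_mul,
      integral_sub hf.integrable_stdGaussian (integrable_const m)] at hle
    simpa [m] using hle
  have h0 : 0 ≤ mgf (fun x => f x - m) γ s := mgf_nonneg
  rw [Real.coe_toNNReal _ (sq_nonneg _), mul_comm _ (s ^ 2)]
  refine le_trans ?_ (integral_exp_sub_le hf s)
  calc mgf (fun x => f x - m) γ s
      ≤ (∫ x, Real.exp (-s * (f x - m)) ∂γ) * ∫ x, Real.exp (s * (f x - m)) ∂γ :=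
        le_mul_of_one_le_left h0 h1
    _ = ∫ p, Real.exp (-s * (f p.1 - m)) * Real.exp (s * (f p.2 - m)) ∂((γ).prod γ) :=
        (integral_prod_mul _ _).symm
    _ = _ := by
        congr 1
        ext p
        rw [← Real.exp_add]
        congr 1
        ring

/-- The variance proxy (π/2)² gives K² = π²/2 < 5.12. The rounded value 5.12 is the one that
produces exactly 32 in the non-centred Gaussian bound. -/
lemma hasConcentration_of_hasLaw_stdGaussian {Ω : Type*} [MeasurableSpace Ω] {μ : Measure Ω}
    {w : Ω → 𝔼} (hw : HasLaw w γ μ) : HasConcentration μ w (√5.12) := by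
  intro f hf
  have hfi : Integrable f γ := hf.integrable_stdGaussian
  have hcomp : ∫ ω, f (w ω) ∂μ = ∫ x, f x ∂γ := hw.integral_comp hfi.1
  refine ⟨?_, fun t ht => ?_⟩
  · have := hfi
    rw [← hw.map_eq] at this
    exact this.comp_aemeasurable hw.aemeasurable
  rw [hcomp, Real.sq_sqrt (by norm_num)]
  set m := ∫ x, f x ∂γ
  have hsg := hf.hasSubgaussianMGF_stdGaussian
  have hmeas : MeasurableSet {x | t ≤ |f x - m|} :=
    measurableSet_le measurable_const (by have := hf.continuous; fun_prop)
  have h1 : μ.real {ω | t ≤ |f (w ω) - m|} = (γ).real {x | t ≤ |f x - m|} := by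
    conv_rhs => rw [← hw.map_eq]
    rw [map_measureReal_apply_of_aemeasurable hw.aemeasurable hmeas]
    rfl
  have hsub : {x | t ≤ |f x - m|} ⊆ {x | t ≤ f x - m} ∪ {x | t ≤ (-fun x => f x - m) x} :=
    fun x hx => by
      simp only [Set.mem_ofPred_eq, Set.mem_union, Pi.neg_apply] at hx ⊢
      exact le_abs.1 hx
  have hexp : Real.exp (-t ^ 2 / (2 * (Real.toNNReal ((Real.pi / 2) ^ 2) : ℝ))) ≤
      Real.exp (-(t ^ 2 / 5.12)) := by
    rw [Real.coe_toNNReal _ (sq_nonneg _), Real.exp_le_exp, neg_div, neg_le_neg_iff]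
    have := Real.pi_lt_d2
    have := Real.pi_pos
    gcongr
    nlinarith
  rw [h1]
  refine (measureReal_mono hsub).trans ((measureReal_union_le _ _).trans ?_)
  have h2 := (hsg.measure_ge_le ht.le).trans hexp
  have h3 := (hsg.neg.measure_ge_le ht.le).trans hexp
  linarith

end Gaussian

/-! ### Non-centred vectors -/

section NonCentred

variable {Ω : Type*} [MeasurableSpace Ω] {μ : Measure Ω} {n : ℕ}

lemma trace_mul_secondMoment {Y : Ω → EuclideanSpace ℝ (Fin n)} (hY : MemLp Y 2 μ)
    (A : Matrix (Fin n) (Fin n) ℝ) :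
    (A * secondMoment μ Y).trace = ∫ ω, quadForm A (Y ω) ∂μ := by
  have hij : ∀ i j, Integrable (fun ω => A i j * (Y ω j * Y ω i)) μ := fun i j =>
    ((hY.eval_piLp j).integrable_mul (hY.eval_piLp i)).const_mul _
  simp only [quadForm_eq_sum, Matrix.trace, Matrix.diag, Matrix.mul_apply, secondMoment,
    Matrix.of_apply]
  rw [integral_finsetSum _ fun i _ => integrable_finsetSum _ fun j _ => hij i j]
  refine Finset.sum_congr rfl fun i _ => ?_
  rw [integral_finsetSum _ fun j _ => hij i j]
  simp only [integral_const_mul]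

variable [IsProbabilityMeasure μ] {Y : Ω → EuclideanSpace ℝ (Fin n)} {K : ℝ}

lemma HasConcentration.hansonWright_of_integral_eq_zero (hY : HasConcentration μ Y K)
    (hK : 0 < K) (hm : AEMeasurable Y μ) (h0 : ∫ ω, Y ω ∂μ = 0) (A : Matrix (Fin n) (Fin n) ℝ)
    {t : ℝ} (ht : 0 < t) :
    μ.real {ω | t ≤ |quadForm A (Y ω) - ∫ ω', quadForm A (Y ω') ∂μ|} ≤
      2 * Real.exp (-(min (t ^ 2 / (K ^ 4 * frobNorm A ^ 2)) (t / (K ^ 2 * specNorm A)) /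
        2400000)) := by
  refine hY.hansonWright hK hm (fun i => ?_) A ht
  rw [← eval_integral_piLp fun i =>
    ((hY.memLp_two hK hm).eval_piLp i).integrable one_le_two, h0]
  rfl

/-- The deviation t is split as εt for the centred quadratic form and (1 − ε)t for the linear term,
whose Lipschitz constant is at most 2‖A‖‖m‖. -/
lemma HasConcentration.hansonWright_add_linear (hY : HasConcentration μ Y K)
    (hK : 0 < K) (hm : AEMeasurable Y μ) (A : Matrix (Fin n) (Fin n) ℝ)
    {t ε : ℝ} (ht : 0 < t) (hε : 0 < ε) (hε1 : ε < 1) :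
    μ.real {ω | t < |quadForm A (Y ω) - ∫ ω', quadForm A (Y ω') ∂μ|} ≤
      2 * Real.exp (-(min ((ε * t) ^ 2 / (K ^ 4 * frobNorm A ^ 2))
        (ε * t / (K ^ 2 * specNorm A)) / 2400000)) +
      2 * Real.exp (-(((1 - ε) * t) ^ 2 / (K * (2 * specNorm A * ‖∫ ω, Y ω ∂μ‖)) ^ 2)) := by
  set m := ∫ ω, Y ω ∂μ
  set a := specNorm A
  have hY2 := hY.memLp_two hK hm
  have ha : 0 ≤ a := specNorm_nonneg A
  -- If this constant vanishes, division by zero turns the last exponential into 1 and the bound is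
  -- trivial.
  rcases (by positivity : 0 ≤ 2 * a * ‖m‖).eq_or_lt with h0 | hpos
  · rw [← h0, mul_zero, zero_pow two_ne_zero, div_zero, neg_zero, Real.exp_zero]
    exact measureReal_le_one.trans (by linarith [Real.exp_pos (-(min ((ε * t) ^ 2 /
      (K ^ 4 * frobNorm A ^ 2)) (ε * t / (K ^ 2 * a)) / 2400000))])
  set b : EuclideanSpace ℝ (Fin n) := WithLp.toLp 2 ((A + A.transpose).mulVec m.ofLp)
  have hb : ‖b‖ ≤ 2 * a * ‖m‖ := (norm_toLp_mulVec_le _ m).trans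
    (mul_le_mul_of_nonneg_right (specNorm_add_transpose_le A) (norm_nonneg m))
  have hlip : LipschitzWith (2 * a * ‖m‖).toNNReal
      (fun x : EuclideanSpace ℝ (Fin n) => inner ℝ x b) :=
    LipschitzWith.of_dist_le_mul fun x y => by
      rw [Real.dist_eq, dist_eq_norm, Real.coe_toNNReal _ hpos.le, ← inner_sub_left, mul_comm]
      exact (abs_real_inner_le_norm _ _).trans (by gcongr)
  obtain ⟨hli, hlt⟩ := hY.of_lipschitz (Real.toNNReal_pos.2 hpos) hlip
  have hlin := hlt ((1 - ε) * t) (by have := sub_pos.2 hε1; positivity)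
  rw [Real.coe_toNNReal _ hpos.le] at hlin
  have hZ : HasConcentration μ (fun ω => Y ω - m) K := by
    have := hY.comp_lipschitz (L := 1) one_pos (φ := fun x => x - m)
      (LipschitzWith.of_dist_le_mul fun x y => by simp)
    simpa using this
  have hZ2 : MemLp (fun ω => Y ω - m) 2 μ := hY2.sub (memLp_const m)
  have hZ0 : ∫ ω, (Y ω - m) ∂μ = 0 := by
    rw [integral_sub (hY2.integrable one_le_two) (integrable_const m), integral_const,
      probReal_univ, one_smul, sub_self]
  have hquad := hZ.hansonWright_of_integral_eq_zero hK (hm.sub_const m) hZ0 A (mul_pos hε ht)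
  have hdec : ∀ ω, quadForm A (Y ω) =
      quadForm A (Y ω - m) + (inner ℝ (Y ω) b + (quadForm A m - inner ℝ m b)) := fun ω => by
    have := quadForm_add A (Y ω - m) m
    rw [sub_add_cancel, inner_sub_left] at this
    rw [this]
    ring
  have hlc : Integrable (fun ω => inner ℝ (Y ω) b + (quadForm A m - inner ℝ m b)) μ :=
    hli.add (integrable_const _)
  have hint : ∫ ω, quadForm A (Y ω) ∂μ = ∫ ω, quadForm A (Y ω - m) ∂μ +
      (∫ ω, inner ℝ (Y ω) b ∂μ + (quadForm A m - inner ℝ m b)) := by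
    simp only [hdec]
    rw [integral_add (integrable_quadForm hZ2 A) hlc,
      integral_add hli (integrable_const _), integral_const, probReal_univ, one_smul]
  refine (measureReal_mono fun ω hω => ?_).trans
    ((measureReal_union_le _ _).trans (add_le_add hquad hlin))
  simp only [Set.mem_ofPred_eq, Set.mem_union] at hω ⊢
  by_contra! hcon
  rw [hdec, hint] at hω
  have := abs_add_le (quadForm A (Y ω - m) - ∫ ω, quadForm A (Y ω - m) ∂μ)
    (inner ℝ (Y ω) b - ∫ ω, inner ℝ (Y ω) b ∂μ)
  have e : ∀ p q r s c : ℝ, p + (q + c) - (r + (s + c)) = (p - r) + (q - s) := by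
    intros
    ring
  rw [e] at hω
  linarith [hcon.1, hcon.2]

end NonCentred

/-! ### Layers -/

section Layer

variable {Ω : Type*} [MeasurableSpace Ω] {μ : Measure Ω} {d n : ℕ}
  {w : Ω → EuclideanSpace ℝ (Fin d)} {X : Matrix (Fin d) (Fin n) ℝ} {σ : ℝ → ℝ} {lam : ℝ≥0}
  {K : ℝ}

lemma aemeasurable_layer (hw : AEMeasurable w μ) (hσ : LipschitzWith lam σ) :
    AEMeasurable (fun ω => layer σ X (w ω)) μ :=
  (lipschitzWith_layer hσ X).continuous.measurable.comp_aemeasurable hw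

lemma HasConcentration.memLp_layer [IsProbabilityMeasure μ] (h : HasConcentration μ w K) (hK : 0 < K)
    (hw : AEMeasurable w μ) (hσ : LipschitzWith lam σ) :
    MemLp (fun ω => layer σ X (w ω)) 2 μ := by
  have hm := aemeasurable_layer (X := X) hw hσ
  refine (memLp_norm_iff hm.aestronglyMeasurable).1 ?_
  have hL := lipschitzWith_one_norm.comp (lipschitzWith_layer hσ X)
  exact (h.integral_sq_sub_le hK hL).1

/-- Both tail bounds for `yᵀ A y`, with an arbitrary splitting parameter in the second. -/
lemma HasConcentration.layer_tail [IsProbabilityMeasure μ] (h : HasConcentration μ w K) (hK : 0 < K)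
    (hw : AEMeasurable w μ) (hσ : LipschitzWith lam σ) (A : Matrix (Fin n) (Fin n) ℝ)
    {t : ℝ} (ht : 0 < t) :
    (∫ ω, layer σ X (w ω) ∂μ = 0 →
      μ.real {ω | t ≤ |quadForm A (layer σ X (w ω)) -
        (A * secondMoment μ fun ω => layer σ X (w ω)).trace|} ≤
      2 * Real.exp (-(min (t ^ 2 / (K ^ 4 * lam ^ 4 * specNorm X ^ 4 * frobNorm A ^ 2))
        (t / (K ^ 2 * lam ^ 2 * specNorm X ^ 2 * specNorm A)) / 2400000))) ∧
    ∀ ε : ℝ, 0 < ε → ε < 1 →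
      μ.real {ω | t < |quadForm A (layer σ X (w ω)) -
        (A * secondMoment μ fun ω => layer σ X (w ω)).trace|} ≤
      2 * Real.exp (-(min ((ε * t) ^ 2 / (K ^ 4 * lam ^ 4 * specNorm X ^ 4 * frobNorm A ^ 2))
        (ε * t / (K ^ 2 * lam ^ 2 * specNorm X ^ 2 * specNorm A)) / 2400000)) +
      2 * Real.exp (-(((1 - ε) * t) ^ 2 / (4 * K ^ 2 * lam ^ 2 * specNorm X ^ 2 *
        specNorm A ^ 2 * ‖∫ ω, layer σ X (w ω) ∂μ‖ ^ 2))) := by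
  rw [trace_mul_secondMoment (h.memLp_layer hK hw hσ)]
  have hX := specNorm_nonneg X
  rcases (by positivity : 0 ≤ lam * specNorm X).eq_or_lt with h0 | hpos
  · have e2 : K ^ 2 * lam ^ 2 * specNorm X ^ 2 * specNorm A = 0 := by
      rw [mul_assoc (K ^ 2), ← mul_pow, ← h0]
      ring
    have e4 : K ^ 4 * lam ^ 4 * specNorm X ^ 4 * frobNorm A ^ 2 = 0 := by
      rw [mul_assoc (K ^ 4), ← mul_pow, ← h0]
      ring
    simp only [e2, e4, div_zero, min_self, zero_div, neg_zero, Real.exp_zero, mul_one]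
    exact ⟨fun _ => measureReal_le_one.trans one_le_two,
      fun ε _ _ => measureReal_le_one.trans (one_le_two.trans (by simp [Real.exp_nonneg]))⟩
  set L : ℝ≥0 := lam * (specNorm X).toNNReal
  have hL : (L : ℝ) = lam * specNorm X := by
    rw [NNReal.coe_mul, Real.coe_toNNReal _ hX]
  have hLpos : 0 < L := by
    rw [← NNReal.coe_pos, hL]
    exact hpos
  have hY := h.comp_lipschitz hLpos (lipschitzWith_layer hσ X)
  rw [hL] at hY
  have hKL : 0 < K * (lam * specNorm X) := by positivity
  have e4 : K ^ 4 * lam ^ 4 * specNorm X ^ 4 * frobNorm A ^ 2 =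
      (K * (lam * specNorm X)) ^ 4 * frobNorm A ^ 2 := by ring
  have e2 : K ^ 2 * lam ^ 2 * specNorm X ^ 2 * specNorm A =
      (K * (lam * specNorm X)) ^ 2 * specNorm A := by ring
  have e1 : 4 * K ^ 2 * lam ^ 2 * specNorm X ^ 2 * specNorm A ^ 2 *
      ‖∫ ω, layer σ X (w ω) ∂μ‖ ^ 2 =
      (K * (lam * specNorm X) * (2 * specNorm A * ‖∫ ω, layer σ X (w ω) ∂μ‖)) ^ 2 := by ring
  rw [e4, e2, e1]
  exact ⟨fun h0 => hY.hansonWright_of_integral_eq_zero hKL (aemeasurable_layer hw hσ) h0 A ht,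
    fun ε hε hε1 => hY.hansonWright_add_linear hKL (aemeasurable_layer hw hσ) A ht hε hε1⟩

/-- Absorbs into C, as one factor 100, the numerical losses from the splitting and from K² = 5.12.
-/
lemma two_mul_exp_neg_min_le {p q p' q' : ℝ} (hp : p ≤ 100 * p') (hq : q ≤ 100 * q') :
    2 * Real.exp (-(min p' q' / 2400000)) ≤ 2 * Real.exp (-(1 / 240000000 * min p q)) := by
  have h : min p q ≤ 100 * min p' q' := by
    rw [mul_min_of_nonneg _ _ (by norm_num)]
    exact min_le_min hp hq
  gcongr
  linarith

/-! ### The mean of a layer under Gaussian input -/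

lemma layer_apply_eq_inner (v : EuclideanSpace ℝ (Fin d)) (i : Fin n) :
    layer σ X v i =
      σ (inner ℝ (WithLp.toLp 2 (fun k => X k i) : EuclideanSpace ℝ (Fin d)) v) := by
  simp [layer, Matrix.vecMul, dotProduct, PiLp.inner_apply]

lemma map_inner_stdGaussian (x : EuclideanSpace ℝ (Fin d)) :
    (stdGaussian (EuclideanSpace ℝ (Fin d))).map (fun v => inner ℝ x v) =
      (gaussianReal 0 1).map (fun r => ‖x‖ * r) := by
  have h := IsGaussian.map_eq_gaussianReal (μ := stdGaussian (EuclideanSpace ℝ (Fin d)))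
    (innerSL ℝ x)
  rw [integral_strongDual_stdGaussian, variance_dual_stdGaussian, innerSL_apply_norm] at h
  rw [gaussianReal_map_const_mul, mul_zero, mul_one]
  convert h using 2
  · ext
    simp
  · exact (Real.toNNReal_of_nonneg (sq_nonneg _)).symm

lemma integrable_lipschitz_gaussianReal (hσ : LipschitzWith lam σ) :
    Integrable σ (gaussianReal 0 1) := by
  have hc := hσ.continuous
  have hid : Integrable (fun x : ℝ => |x|) (gaussianReal 0 1) :=
    (IsGaussian.integrable_id (μ := gaussianReal 0 1)).norm
  refine ((integrable_const |σ 0|).add (hid.const_mul lam)).mono' (by fun_prop)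
    (Filter.Eventually.of_forall fun x => ?_)
  have h := hσ.dist_le_mul x 0
  rw [Real.dist_eq, Real.dist_eq, sub_zero] at h
  rw [Real.norm_eq_abs]
  simp only [Pi.add_apply]
  linarith [abs_sub_abs_le_abs_sub (σ x) (σ 0)]

lemma integral_abs_gaussianReal_le_one : ∫ x, |x| ∂(gaussianReal 0 1) ≤ 1 := by
  have h2 : MemLp id 2 (gaussianReal 0 1) := memLp_id_gaussianReal' 2 (by simp)
  have hsq : ∫ x, x ^ 2 ∂(gaussianReal 0 1) = 1 := by
    have h := variance_id_gaussianReal (μ := 0) (v := 1)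
    rw [variance_eq_sub h2] at h
    simpa using h
  have hi : Integrable (fun x : ℝ => x ^ 2) (gaussianReal 0 1) := h2.integrable_sq
  calc ∫ x, |x| ∂(gaussianReal 0 1) ≤ ∫ x, (1 / 2 + 1 / 2 * x ^ 2) ∂(gaussianReal 0 1) := by
        refine integral_mono (h2.integrable one_le_two).abs
          ((integrable_const _).add (hi.const_mul _)) fun x => ?_
        simp only
        nlinarith [sq_nonneg (|x| - 1), sq_abs x]
    _ = 1 := by
        rw [integral_add (integrable_const _) (hi.const_mul _), integral_const_mul, hsq]
        norm_num

/-- Coordinate i has mean 𝔼σ(‖xᵢ‖ξ), which differs from c = 𝔼σ(ξ) by at most λ|‖xᵢ‖ − 1| 𝔼|ξ|, and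
𝔼|ξ| ≤ 1. Then u² ≤ 2(u − c)² + 2c². -/
lemma norm_integral_layer_sq_le_tZero
    (hw : HasLaw w (stdGaussian (EuclideanSpace ℝ (Fin d))) μ) (hσ : LipschitzWith lam σ)
    (hint : Integrable (fun ω => layer σ X (w ω)) μ) :
    ‖∫ ω, layer σ X (w ω) ∂μ‖ ^ 2 ≤ tZero lam σ X := by
  set c := ∫ x, σ x ∂(gaussianReal 0 1)
  set x : Fin n → EuclideanSpace ℝ (Fin d) := fun i => WithLp.toLp 2 (fun k => X k i)
  have hc := hσ.continuous
  have hi : Integrable σ (gaussianReal 0 1) := integrable_lipschitz_gaussianReal hσ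
  have hcoord : ∀ i, (∫ ω, layer σ X (w ω) ∂μ) i = ∫ r, σ (‖x i‖ * r) ∂(gaussianReal 0 1) :=
    fun i => by
      rw [eval_integral_piLp fun i => hint.eval_piLp i]
      simp only [layer_apply_eq_inner]
      have h1 : ∫ ω, σ (inner ℝ (x i) (w ω)) ∂μ =
          ∫ v, σ (inner ℝ (x i) v) ∂(stdGaussian (EuclideanSpace ℝ (Fin d))) :=
        hw.integral_comp (f := fun v => σ (inner ℝ (x i) v)) (by fun_prop)
      rw [h1, ← integral_map (φ := fun v => inner ℝ (x i) v) (by fun_prop) (by fun_prop),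
        map_inner_stdGaussian, integral_map (by fun_prop) (by fun_prop)]
  have hdist : ∀ i, |(∫ ω, layer σ X (w ω) ∂μ) i - c| ≤ lam * |‖x i‖ - 1| := fun i => by
    have hs : Integrable (fun r => σ (‖x i‖ * r)) (gaussianReal 0 1) :=
      integrable_lipschitz_gaussianReal (lam := lam * ‖x i‖₊)
        (hσ.comp (LipschitzWith.of_dist_le_mul fun a b => by
          simp [Real.dist_eq, ← mul_sub, abs_mul]))
    rw [hcoord, ← integral_sub hs hi]
    have hid : Integrable (fun x : ℝ => |x|) (gaussianReal 0 1) :=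
      (IsGaussian.integrable_id (μ := gaussianReal 0 1)).norm
    calc |∫ r, (σ (‖x i‖ * r) - σ r) ∂(gaussianReal 0 1)|
        ≤ ∫ r, |σ (‖x i‖ * r) - σ r| ∂(gaussianReal 0 1) := abs_integral_le_integral_abs
      _ ≤ ∫ r, lam * |‖x i‖ - 1| * |r| ∂(gaussianReal 0 1) := by
          refine integral_mono (hs.sub hi).abs (hid.const_mul _) fun r => ?_
          have := hσ.dist_le_mul (‖x i‖ * r) r
          rw [Real.dist_eq, Real.dist_eq] at this
          refine this.trans_eq ?_
          rw [mul_assoc, ← abs_mul, sub_mul, one_mul]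
      _ ≤ lam * |‖x i‖ - 1| := by
          rw [integral_const_mul]
          exact mul_le_of_le_one_right (by positivity) integral_abs_gaussianReal_le_one
  have hsq : ∀ i, (∫ ω, layer σ X (w ω) ∂μ) i ^ 2 ≤
      2 * lam ^ 2 * (‖x i‖ - 1) ^ 2 + 2 * c ^ 2 := fun i => by
    have h1 := pow_le_pow_left₀ (abs_nonneg _) (hdist i) 2
    rw [sq_abs, mul_pow, sq_abs] at h1
    nlinarith [sq_nonneg ((∫ ω, layer σ X (w ω) ∂μ) i - 2 * c)]
  rw [EuclideanSpace.real_norm_sq_eq]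
  refine (Finset.sum_le_sum fun i _ => hsq i).trans_eq ?_
  rw [Finset.sum_add_distrib, ← Finset.mul_sum, Finset.sum_const, Finset.card_univ,
    Fintype.card_fin, nsmul_eq_mul, tZero]
  ring

lemma quadForm_layer_eq_trace_of_degenerate [IsProbabilityMeasure μ] (hσ : LipschitzWith lam σ)
    {A : Matrix (Fin n) (Fin n) ℝ} (h : lam = 0 ∨ X = 0 ∨ A = 0) (ω : Ω) :
    quadForm A (layer σ X (w ω)) = (A * secondMoment μ fun ω => layer σ X (w ω)).trace := by
  by_cases hA : A = 0
  · simp [hA, quadForm]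
  have hc : ∀ ω, layer σ X (w ω) = layer σ X 0 := fun ω => by
    ext i
    rcases h with rfl | rfl | h
    · have := hσ.dist_le_mul (Matrix.vecMul (w ω).ofLp X i) (Matrix.vecMul 0 X i)
      rw [NNReal.coe_zero, zero_mul] at this
      exact dist_le_zero.1 this
    · simp [layer]
    · exact absurd h hA
  simp only [hc]
  rw [trace_mul_secondMoment (memLp_const _)]
  simp

end Layer

/-! ### The main theorem: choice of constants -/

theorem mainTheorem4 :
    ∃ C : ℝ, 0 < C ∧
      ∀ (Ω : Type*) [MeasurableSpace Ω] (μ : Measure Ω) [IsProbabilityMeasure μ]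
        (d n : ℕ) (w : Ω → EuclideanSpace ℝ (Fin d)) (_ : AEMeasurable w μ)
        (X : Matrix (Fin d) (Fin n) ℝ) (σ : ℝ → ℝ) (lam : ℝ≥0) (_ : LipschitzWith lam σ)
        (A : Matrix (Fin n) (Fin n) ℝ)
        (y : Ω → EuclideanSpace ℝ (Fin n)) (_ : y = fun ω => layer σ X (w ω))
        (Φ : Matrix (Fin n) (Fin n) ℝ) (_ : Φ = secondMoment μ y),
        -- degenerate case (vanishing denominators below): no fluctuation at all
        ((lam = 0 ∨ X = 0 ∨ A = 0) → ∀ ω, quadForm A (y ω) = (A * Φ).trace) ∧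
        -- general random vectors with the `K`-concentration property
        (∀ K : ℝ, 0 < K → HasConcentration μ w K →
          MemLp y 2 μ ∧
          (∫ ω, y ω ∂μ = 0 → ∀ t : ℝ, 0 < t →
            μ.real {ω | t ≤ |quadForm A (y ω) - (A * Φ).trace|} ≤
              2 * Real.exp (-(1 / C * min
                (t ^ 2 / (2 * K ^ 4 * lam ^ 4 * specNorm X ^ 4 * frobNorm A ^ 2))
                (t / (K ^ 2 * lam ^ 2 * specNorm X ^ 2 * specNorm A))))) ∧
          (∫ ω, y ω ∂μ ≠ 0 → ∀ t : ℝ, 0 < t →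
            μ.real {ω | t < |quadForm A (y ω) - (A * Φ).trace|} ≤
              2 * Real.exp (-(1 / C * min
                (t ^ 2 / (4 * K ^ 4 * lam ^ 4 * specNorm X ^ 4 * frobNorm A ^ 2))
                (t / (K ^ 2 * lam ^ 2 * specNorm X ^ 2 * specNorm A)))) +
              2 * Real.exp (-(t ^ 2 /
                (16 * K ^ 2 * lam ^ 2 * specNorm X ^ 2 * specNorm A ^ 2 *
                  ‖∫ ω, y ω ∂μ‖ ^ 2))))) ∧
        -- standard Gaussian random vectors
        (HasLaw w (stdGaussian (EuclideanSpace ℝ (Fin d))) μ →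
          MemLp y 2 μ ∧
          (∫ ω, y ω ∂μ = 0 → ∀ t : ℝ, 0 < t →
            μ.real {ω | t ≤ |quadForm A (y ω) - (A * Φ).trace|} ≤
              2 * Real.exp (-(1 / C * min
                (t ^ 2 / (4 * lam ^ 4 * specNorm X ^ 4 * frobNorm A ^ 2))
                (t / (lam ^ 2 * specNorm X ^ 2 * specNorm A))))) ∧
          (∫ ω, y ω ∂μ ≠ 0 → ∀ t : ℝ, 0 < t →
            μ.real {ω | t < |quadForm A (y ω) - (A * Φ).trace|} ≤
              2 * Real.exp (-(1 / C * min
                (t ^ 2 / (8 * lam ^ 4 * specNorm X ^ 4 * frobNorm A ^ 2))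
                (t / (lam ^ 2 * specNorm X ^ 2 * specNorm A)))) +
              2 * Real.exp (-(t ^ 2 /
                (32 * lam ^ 2 * specNorm X ^ 2 * specNorm A ^ 2 *
                  ‖∫ ω, y ω ∂μ‖ ^ 2))) ∧
            2 * Real.exp (-(1 / C * min
                (t ^ 2 / (8 * lam ^ 4 * specNorm X ^ 4 * frobNorm A ^ 2))
                (t / (lam ^ 2 * specNorm X ^ 2 * specNorm A)))) +
              2 * Real.exp (-(t ^ 2 /
                (32 * lam ^ 2 * specNorm X ^ 2 * specNorm A ^ 2 *
                  ‖∫ ω, y ω ∂μ‖ ^ 2))) ≤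
            2 * Real.exp (-(1 / C * min
                (t ^ 2 / (8 * lam ^ 4 * specNorm X ^ 4 * frobNorm A ^ 2))
                (t / (lam ^ 2 * specNorm X ^ 2 * specNorm A)))) +
              2 * Real.exp (-(t ^ 2 /
                (32 * lam ^ 2 * specNorm X ^ 2 * specNorm A ^ 2 * tZero lam σ X)))) ∧
          (Integrable σ (gaussianReal 0 1) ∧
            ‖∫ ω, y ω ∂μ‖ ^ 2 ≤ tZero lam σ X)) := by
  refine ⟨240000000, by norm_num, ?_⟩
  intro Ω _ μ _ d n w hw X σ lam hσ A y hy Φ hΦ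
  subst hy hΦ
  have hX := specNorm_nonneg X
  have hA := specNorm_nonneg A
  refine ⟨fun h ω => quadForm_layer_eq_trace_of_degenerate hσ h ω, fun K hK hc => ?_,
    fun hlaw => ?_⟩
  · refine ⟨hc.memLp_layer hK hw hσ, fun h0 t ht => ?_, fun _ t ht => ?_⟩
    all_goals
      have hp : 0 ≤ t ^ 2 / (K ^ 4 * lam ^ 4 * specNorm X ^ 4 * frobNorm A ^ 2) := by positivity
      have hq : 0 ≤ t / (K ^ 2 * lam ^ 2 * specNorm X ^ 2 * specNorm A) := by positivity
    · refine ((hc.layer_tail hK hw hσ A ht).1 h0).trans (two_mul_exp_neg_min_le ?_ ?_)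
      · rw [show t ^ 2 / (2 * K ^ 4 * lam ^ 4 * specNorm X ^ 4 * frobNorm A ^ 2) =
          1 / 2 * (t ^ 2 / (K ^ 4 * lam ^ 4 * specNorm X ^ 4 * frobNorm A ^ 2)) by ring]
        linarith
      · linarith
    -- Equal splitting: (t/2)² over 4K²… gives the 16.
    · refine ((hc.layer_tail hK hw hσ A ht).2 (1 / 2) (by norm_num) (by norm_num)).trans
        (add_le_add (two_mul_exp_neg_min_le ?_ ?_) (le_of_eq ?_))
      · rw [show t ^ 2 / (4 * K ^ 4 * lam ^ 4 * specNorm X ^ 4 * frobNorm A ^ 2) =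
          (1 / 2 * t) ^ 2 / (K ^ 4 * lam ^ 4 * specNorm X ^ 4 * frobNorm A ^ 2) by ring]
        have : 0 ≤ (1 / 2 * t) ^ 2 / (K ^ 4 * lam ^ 4 * specNorm X ^ 4 * frobNorm A ^ 2) := by
          positivity
        linarith
      · rw [mul_div_assoc]
        linarith
      · congr 3
        ring
  · have hc := hasConcentration_of_hasLaw_stdGaussian hlaw
    have hK : 0 < √(5.12 : ℝ) := Real.sqrt_pos.2 (by norm_num)
    have hK2 : √(5.12 : ℝ) ^ 2 = 5.12 := Real.sq_sqrt (by norm_num)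
    have hK4 : √(5.12 : ℝ) ^ 4 = 26.2144 := by
      rw [show √(5.12 : ℝ) ^ 4 = (√(5.12 : ℝ) ^ 2) ^ 2 by ring, hK2]
      norm_num
    have hmem := hc.memLp_layer (X := X) hK hw hσ
    have ht0 := norm_integral_layer_sq_le_tZero hlaw hσ (hmem.integrable one_le_two)
    refine ⟨hmem, fun h0 t ht => ?_, fun hne t ht => ⟨?_, ?_⟩,
      integrable_lipschitz_gaussianReal hσ, ht0⟩
    · have hp : 0 ≤ t ^ 2 / (lam ^ 4 * specNorm X ^ 4 * frobNorm A ^ 2) := by positivity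
      have hq : 0 ≤ t / (lam ^ 2 * specNorm X ^ 2 * specNorm A) := by positivity
      refine ((hc.layer_tail hK hw hσ A ht).1 h0).trans (two_mul_exp_neg_min_le ?_ ?_)
      · rw [hK4, show t ^ 2 / (4 * lam ^ 4 * specNorm X ^ 4 * frobNorm A ^ 2) =
          1 / 4 * (t ^ 2 / (lam ^ 4 * specNorm X ^ 4 * frobNorm A ^ 2)) by ring,
          show t ^ 2 / (26.2144 * lam ^ 4 * specNorm X ^ 4 * frobNorm A ^ 2) =
          1 / 26.2144 * (t ^ 2 / (lam ^ 4 * specNorm X ^ 4 * frobNorm A ^ 2)) by ring]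
        linarith
      · rw [hK2, show t / (5.12 * lam ^ 2 * specNorm X ^ 2 * specNorm A) =
          1 / 5.12 * (t / (lam ^ 2 * specNorm X ^ 2 * specNorm A)) by ring]
        linarith
    · have hp : 0 ≤ t ^ 2 / (lam ^ 4 * specNorm X ^ 4 * frobNorm A ^ 2) := by positivity
      have hq : 0 ≤ t / (lam ^ 2 * specNorm X ^ 2 * specNorm A) := by positivity
      -- Unequal splitting: (4/5)²/(4 · 5.12) = 1/32. The quadratic part pays 25 · 5.12² = 655.36
      -- against 8, a ratio below 100.
      refine ((hc.layer_tail hK hw hσ A ht).2 (1 / 5) (by norm_num) (by norm_num)).trans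
        (add_le_add (two_mul_exp_neg_min_le ?_ ?_) (le_of_eq ?_))
      · rw [hK4, show t ^ 2 / (8 * lam ^ 4 * specNorm X ^ 4 * frobNorm A ^ 2) =
          1 / 8 * (t ^ 2 / (lam ^ 4 * specNorm X ^ 4 * frobNorm A ^ 2)) by ring,
          show (1 / 5 * t) ^ 2 / (26.2144 * lam ^ 4 * specNorm X ^ 4 * frobNorm A ^ 2) =
          1 / 655.36 * (t ^ 2 / (lam ^ 4 * specNorm X ^ 4 * frobNorm A ^ 2)) by ring]
        linarith
      · rw [hK2, show 1 / 5 * t / (5.12 * lam ^ 2 * specNorm X ^ 2 * specNorm A) =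
          1 / 25.6 * (t / (lam ^ 2 * specNorm X ^ 2 * specNorm A)) by ring]
        linarith
      · congr 3
        rw [hK2]
        ring
    -- Positivity matters: with the convention x/0 = 0, enlarging a zero denominator would not
    -- decrease the quotient.
    · have hm : 0 < ‖∫ ω, layer σ X (w ω) ∂μ‖ ^ 2 := by
        have := norm_pos_iff.2 hne
        positivity
      gcongr 2 * _ + 2 * Real.exp (-?_)
      rcases (by positivity : 0 ≤ 32 * (lam : ℝ) ^ 2 * specNorm X ^ 2 * specNorm A ^ 2).eq_or_lt
        with h0 | hpos
      · simp [← h0]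
      · gcongr
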